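/- The Selberg class $\mathcal S$ consists of the functions $L(s)$ that are given for $\operatorname{Re} s>1$ by an absolutely convergent Dirichlet series $\sum_{n\ge1}a_L(n)n^{-s}$ and satisfy: (i) $a_L(n)\ll_\varepsilon n^\varepsilon$ for every $\varepsilon>0$; (ii) for some integer $m_L\ge0$ the function $(s-1)^{m_L}L(s)$ is entire of finite order; (iii) $\Lambda(s)=\theta\,\overline{\Lambda(1-\overline s)}$, where $\Lambda(s)=L(s)Q^s\prod_{j=1}^{r}\Gamma(\lambda_js+\mu_j)$ with $|\theta|=1$, $Q>0$, $\lambda_j>0$ and $\operatorname{Re}\mu_j\ge0$; (iv) $\log L(s)=\sum_p\sum_{k\ge1}b_L(p^k)p^{-ks}$ for $\operatorname{Re} s>1$, where $b_L(p^k)\ll p^{k\vartheta}$ for some $\vartheta<1/2$. For $L\in\mathcal S$ let $\sigma_{\mathrm m}(L)$ be the abscissa of the mean-square half-plane, i.e. the infimum of the real $\sigma_0$ such that $$\lim_{T\to\infty}\frac1{2T}\int_{-T}^{T}|L(\sigma+it)|^2\,dt=\sum_{n\ge1}\frac{|a_L(n)|^2}{n^{2\sigma}}<\infty\qquad\text{for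 all }\sigma>\sigma_0,\ \sigma\neq1.$$ **Proposition.** Let $m\ge1$ and let $L_1,\dots,L_m\in\mathcal S$ satisfy, as $x\to\infty$, $$\sum_{p\le x}|a_{L_k}(p)|^2=\sum_{j=1}^{2m+1}\frac{c^{(k)}_j\,x}{(\log x)^j}+O\!\left(\frac{x}{(\log x)^{2m+2}}\right)\quad(1\le k\le m),$$ $$\sum_{p\le x}a_{L_k}(p)\overline{a_{L_l}(p)}=\sum_{j=2}^{2m+1}\frac{c^{(k,l)}_j\,x}{(\log x)^j}+O\!\left(\frac{x}{(\log x)^{2m+2}}\right)\quad(1\le k\ne l\le m),$$ with constants $c^{(k)}_j\in\mathbb R$, $c^{(k,l)}_j\in\mathbb C$ and $c^{(k)}_1>0$. Let $\max_{1\le j\le m}\sigma_{\mathrm m}(L_j)<\sigma_1<\sigma_2<1$, let $D=\{s\in\mathbb C:\sigma_1<\operatorname{Re}s<\sigma_2\}$, and let $H(D)$ be the space of holomorphic functions on $D$ with the topology of uniform convergence on compact subsets. Let $\Omega=\prod_p\{z\in\mathbb C:|z|=1\}$, the product being over all primes $p$, and for $\omega=(\omega(p))_p\in\Omega$ put $$g_{p,j}(s,\omega(p))=\sum_{k=1}^\infty\frac{b_{L_j}(p^k)\,\omega(p)^k}{p^{ks}},\qquad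 \underline g_p(s,\omega(p))=\bigl(g_{p,1}(s,\omega(p)),\dots,g_{p,m}(s,\omega(p))\bigr)\qquad(s\in D).$$ Then the set of the sums of all those series $\sum_p\underline g_p(s,\omega(p))$, $\omega\in\Omega$, that converge in $H(D)^m$ (as limits of the partial sums over $p\le N$, $N\to\infty$) is dense in $H(D)^m$. -/

import Mathlib

open Filter Topology Asymptotics

noncomputable section

/-- The completed function `L(s) Q^s ∏_j Γ(λ_j s + μ_j)` attached to the data of a
functional equation. -/
def completedL (L : ℂ → ℂ) (Q : ℝ) {r : ℕ} (lam : Fin r → ℝ) (mu : Fin r → ℂ) (s : ℂ) : ℂ :=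
  L s * (Q : ℂ) ^ s * ∏ j, Complex.Gamma ((lam j : ℂ) * s + mu j)

/-- An element of the Selberg class, together with its (uniquely determined) Dirichlet
coefficients `a n`, `n ≥ 1`, and the (uniquely determined) coefficients `b (p ^ k)`, `p` prime,
`k ≥ 1`, of its logarithm. The values `a 0` and `b n`, `n` not a prime power, and the value of
`L` at the possible pole `s = 1` play no role. -/
structure SelbergClass where
  /-- the function, continued to `ℂ \ {1}` -/
  L : ℂ → ℂ
  /-- the Dirichlet coefficients -/
  a : ℕ → ℂ
  /-- the coefficients of `log L` -/
  b : ℕ → ℂ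
  /-- Dirichlet series (absolutely convergent) in `Re s > 1` -/
  dirichlet : ∀ s : ℂ, 1 < s.re → LSeriesHasSum a s (L s)
  /-- (i) Ramanujan hypothesis -/
  ramanujan : ∀ ε : ℝ, 0 < ε → a =O[atTop] fun n : ℕ => (n : ℝ) ^ ε
  /-- (ii) `(s - 1)^r L(s)` extends to an entire function of finite order -/
  continuation : ∃ (r : ℕ) (F : ℂ → ℂ), Differentiable ℂ F ∧
    (∀ s : ℂ, s ≠ 1 → F s = (s - 1) ^ r * L s) ∧
    ∃ A C : ℝ, 0 < A ∧ ∀ s : ℂ, ‖F s‖ ≤ C * Real.exp (‖s‖ ^ A)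
  /-- (iii) functional equation, an identity of meromorphic functions, stated at all points at
  which none of the factors on either side can have a pole -/
  functionalEquation : ∃ (θ : ℂ) (Q : ℝ) (r : ℕ) (lam : Fin r → ℝ) (mu : Fin r → ℂ),
    ‖θ‖ = 1 ∧ 0 < Q ∧ (∀ j, 0 < lam j) ∧ (∀ j, 0 ≤ (mu j).re) ∧
    ∀ s : ℂ, s ≠ 0 → s ≠ 1 →
      (∀ (j : Fin r) (n : ℕ), (lam j : ℂ) * s + mu j ≠ -(n : ℂ)) →
      (∀ (j : Fin r) (n : ℕ),
        (lam j : ℂ) * (1 - (starRingEnd ℂ) s) + mu j ≠ -(n : ℂ)) →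
      completedL L Q lam mu s =
        θ * (starRingEnd ℂ) (completedL L Q lam mu (1 - (starRingEnd ℂ) s))
  /-- (iv) Euler product: `log L(s) = ∑_p ∑_{k ≥ 1} b(p^k) p^{-ks}` in `Re s > 1`
  (the exponent `k` is written `q.2 + 1`) -/
  euler : ∀ s : ℂ, 1 < s.re → ∃ l : ℂ,
    HasSum (fun q : Nat.Primes × ℕ =>
      b ((q.1 : ℕ) ^ (q.2 + 1)) * ((q.1 : ℕ) : ℂ) ^ (-((q.2 + 1 : ℕ) : ℂ) * s)) l ∧
    L s = Complex.exp l
  /-- (iv) bound for the coefficients of the Euler product -/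
  euler_bound : ∃ θ C : ℝ, θ < 1 / 2 ∧ ∀ p k : ℕ, p.Prime → 1 ≤ k →
    ‖b (p ^ k)‖ ≤ C * (p : ℝ) ^ ((k : ℝ) * θ)

/-- The mean-square formula for `L` on the vertical line `Re s = σ`:
`(1 / 2T) ∫_{-T}^T |L(σ + it)|² dt → ∑_{n ≥ 1} |a(n)|² n^{-2σ} < ∞` as `T → ∞`. -/
def SelbergClass.MeanSquareAt (F : SelbergClass) (σ : ℝ) : Prop :=
  Summable (fun n : ℕ => ‖F.a (n + 1)‖ ^ 2 / ((n + 1 : ℕ) : ℝ) ^ (2 * σ)) ∧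
  Tendsto (fun T : ℝ =>
      1 / (2 * T) * ∫ t in (-T)..T, ‖F.L ((σ : ℂ) + (t : ℂ) * Complex.I)‖ ^ 2) atTop
    (𝓝 (∑' n : ℕ, ‖F.a (n + 1)‖ ^ 2 / ((n + 1 : ℕ) : ℝ) ^ (2 * σ)))

/-- The abscissa `σ_m(L)` of the mean-square half-plane of `L`: the infimum of the `σ₀` such that
the mean-square formula holds on all lines to the right of `σ₀`. The line `σ = 1` is left out, as
it may contain a pole. -/
def SelbergClass.meanSquareAbscissa (F : SelbergClass) : EReal :=
  sInf ((fun r : ℝ => (r : EReal)) ''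
    {σ₀ : ℝ | ∀ σ : ℝ, σ₀ < σ → σ ≠ 1 → F.MeanSquareAt σ})

/-- `∑_{p ≤ x} f(p)`, the sum over primes. -/
def primeSum {E : Type*} [AddCommMonoid E] (f : ℕ → E) (x : ℝ) : E :=
  ∑ p ∈ (Finset.Icc 1 ⌊x⌋₊).filter Nat.Prime, f p

/-- `∑_{p ≤ x} |a_{L_k}(p)|² = ∑_{j=1}^{2m+1} c_j^{(k)} x / (log x)^j + O(x / (log x)^{2m+2})`
with `c_1^{(k)} > 0`, for `1 ≤ k ≤ m`. -/
def SelbergStrongA {m : ℕ} (L : Fin m → SelbergClass) : Prop :=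
  ∀ k : Fin m, ∃ c : ℕ → ℝ, 0 < c 1 ∧
    (fun x : ℝ => primeSum (fun p => ‖(L k).a p‖ ^ 2) x -
        ∑ j ∈ Finset.Icc 1 (2 * m + 1), c j * x / Real.log x ^ j)
      =O[atTop] fun x : ℝ => x / Real.log x ^ (2 * m + 2)

/-- `∑_{p ≤ x} a_{L_k}(p) conj(a_{L_l}(p)) =
∑_{j=2}^{2m+1} c_j^{(k,l)} x / (log x)^j + O(x / (log x)^{2m+2})`, for `1 ≤ k ≠ l ≤ m`. -/
def SelbergStrongB {m : ℕ} (L : Fin m → SelbergClass) : Prop :=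
  ∀ k l : Fin m, k ≠ l → ∃ c : ℕ → ℂ,
    (fun x : ℝ => primeSum (fun p => (L k).a p * (starRingEnd ℂ) ((L l).a p)) x -
        ∑ j ∈ Finset.Icc 2 (2 * m + 1), c j * (x : ℂ) / (Real.log x : ℂ) ^ j)
      =O[atTop] fun x : ℝ => x / Real.log x ^ (2 * m + 2)

/-- The open vertical strip `σ₁ < Re s < σ₂`. -/
def verticalStrip (σ₁ σ₂ : ℝ) : Set ℂ := {s : ℂ | σ₁ < s.re ∧ s.re < σ₂}

/-- The space `H(D)` of holomorphic functions on (an open set) `D`, as a subspace of the space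
`C(D, ℂ)`, whose topology is the compact-open one, i.e. uniform convergence on compact subsets. -/
def HolFun (D : Set ℂ) : Submodule ℂ C(D, ℂ) where
  carrier := {f | ∃ F : ℂ → ℂ, DifferentiableOn ℂ F D ∧ ∀ z : D, F z = f z}
  zero_mem' := ⟨fun _ => 0, differentiableOn_const 0, fun _ => rfl⟩
  add_mem' := by
    rintro f g ⟨F, hF, hf⟩ ⟨G, hG, hg⟩
    exact ⟨F + G, hF.add hG, fun z => by simp [hf, hg]⟩
  smul_mem' := by
    rintro c f ⟨F, hF, hf⟩
    exact ⟨c • F, hF.const_smul c, fun z => by simp [hf]⟩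

/-- The infinite-dimensional torus `Ω = ∏_p {|s| = 1}`. -/
abbrev InfiniteTorus : Type := Nat.Primes → Circle

/-- The primes `p ≤ N`. -/
def primesUpTo (N : ℕ) : Finset Nat.Primes := (Finset.Icc 1 N).subtype Nat.Prime

/-- `G` is the function `g_{p,j}(s, ω(p)) = ∑_{k ≥ 1} b_{L_j}(p^k) ω(p)^k p^{-ks}` on `D`, for all
`p` and `j`; the convergence of the series in `k` at each `s ∈ D` is part of the assertion
(`k` is written `k + 1`). -/
def IsLocalLog {m : ℕ} (L : Fin m → SelbergClass) (D : Set ℂ) (ω : InfiniteTorus)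
    (G : Nat.Primes → Fin m → HolFun D) : Prop :=
  ∀ (p : Nat.Primes) (j : Fin m) (s : D),
    HasSum (fun k : ℕ => (L j).b ((p : ℕ) ^ (k + 1)) * (ω p : ℂ) ^ (k + 1) *
      ((p : ℕ) : ℂ) ^ (-((k + 1 : ℕ) : ℂ) * (s : ℂ))) ((G p j : C(D, ℂ)) s)

/-- The set of (the sums of) the convergent series `∑_p g_p(s, ω(p))`, `ω ∈ Ω`: convergence in
`H(D)^m` of the partial sums over `p ≤ N` as `N → ∞`. -/
def convergentSeries {m : ℕ} (L : Fin m → SelbergClass) (D : Set ℂ) : Set (Fin m → HolFun D) :=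
  {f | ∃ (ω : InfiniteTorus) (G : Nat.Primes → Fin m → HolFun D), IsLocalLog L D ω G ∧
    Tendsto (fun N : ℕ => ∑ p ∈ primesUpTo N, G p) atTop (𝓝 f)}

end

/-!
The proof separates the approximation problem on a compact subset `K` of the strip `D` into a
functional-analytic part, in which the coefficients `ω(p)` may have any modulus `≤ 1`, and a
rounding part.

**Coefficients in the unit disc.** Let `g` be a tuple of holomorphic functions which is not a limit
in `C(K)^m` of finite combinations `∑_{p > N} z_p (a_j(p) p^{-s})_j` with `|z_p| ≤ 1`. These
combinations form a convex set, so some functional `φ = (φ_j)_j` is bounded on them while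
`φ(g) ≠ 0`. Choosing the arguments of the `z_p` one gets `∑_p |∑_j a_j(p) ρ_j(log p)| < ∞` with
`ρ_j(x) = φ_j(e^{-xs})`. Near `x = u` the function `ρ_j` is, up to an error `O(e^{-2u})`, a
polynomial of degree `O(u)`, so by Markov's inequality it is almost constant on intervals of length
`κ / u²` around the point of `[u, u + 1]` at which `max_j |ρ_j|` is largest
(`exists_slow_variation`). The prime sums in the hypotheses are precise enough to be evaluated on
such short intervals of `log p` (`tendsto_increment`), where the `a_j` are orthogonal to leading
order; hence `ρ_j(x) = O(e^{-βx})` for every `β < 1` (`eventually_norm_le_exp_neg`).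

The Cauchy transform `w ↦ φ_j((w - s)⁻¹)` is holomorphic off `K`, and to the left of `K` it is,
up to sign, the Laplace transform of `ρ_j`, which for `σ₂ < β < 1` continues across `K`. So it
extends to an entire function tending to `0` at infinity and vanishes, as does `φ_j` on all
exponentials (`map_expFun_eq_zero`). As these approximate holomorphic functions
(`map_eq_zero_of_map_expFun_eq_zero`), `φ(g) = 0`, a contradiction. This is
`exists_combination_near`.

**Rounding.** The finiteness of the mean square forces `σ₁ > 1/2`
(`half_lt_of_meanSquareAbscissa_lt`), so the vectors `(a_j(p) p^{-σ₁})_j` are square summable. The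
`z_p` can therefore be replaced greedily by numbers of modulus one such that all partial sums at
`s = σ₁` change by little (`exists_circle_rounding`), and by Abel summation the series of the
changes converges to something small on `K`, and locally uniformly on `D`
(`exists_tendstoUniformlyOn_dirichlet`).

**Higher prime powers.** Newton's identities bound each `b(p^k)` by `p^ε`, and together with the
bound on the `b(p^k)` for large `k` they show that the terms with `k ≥ 2` are summable over all
`p` and `k` (`exists_higher_bound`). The local factors at the primes `p ≤ N`, where `ω(p) = 1`, are
subtracted from the function to be approximated; beyond a large `N` the terms with `k ≥ 2` are
negligible.
-/

/-! ### Markov's inequality and slow variation of `u ↦ φ(e^{-us})` -/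

section SlowVariation

open Polynomial in
/-- Markov's inequality at the end point `1`, where the Chebyshev polynomial is extremal. -/
theorem abs_eval_one_derivative_le {n : ℕ} {P : ℝ[X]} {M : ℝ} (hM : 0 < M) (hP : P.degree ≤ n)
    (h : ∀ x ∈ Set.Icc (-1 : ℝ) 1, |P.eval x| ≤ M) :
    |P.derivative.eval 1| ≤ n ^ 2 * M := by
  have key : ∀ Q : ℝ[X], Q.degree ≤ n → (∀ x ∈ Set.Icc (-1 : ℝ) 1, |Q.eval x| ≤ M) →
      Q.derivative.eval 1 ≤ n ^ 2 * M := by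
    intro Q hQ hb
    have h1 := Polynomial.Chebyshev.eval_iterate_derivative_le_of_forall_abs_le_one
      (n := n) (P := C M⁻¹ * Q) (k := 1) (x := 1) le_rfl
      (by rwa [degree_C_mul (inv_pos.mpr hM).ne']) (by
        intro x hx
        rw [eval_C_mul, abs_mul, abs_of_pos (inv_pos.mpr hM), inv_mul_le_iff₀ hM, mul_one]
        exact hb x hx)
    simp only [Function.iterate_one, derivative_C_mul, eval_C_mul] at h1
    have h2 : (derivative (Chebyshev.T ℝ (n : ℤ))).eval 1 = (n : ℝ) ^ 2 := by
      rw [Chebyshev.T_derivative_eq_U]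
      simp [Chebyshev.U_eval_one]
      ring
    rw [h2, inv_mul_le_iff₀ hM] at h1
    linarith
  rw [abs_le]
  refine ⟨?_, key P hP h⟩
  have := key (-P) (by rwa [degree_neg]) (by simpa using h)
  simp only [derivative_neg, eval_neg] at this
  linarith

open Polynomial in
/-- Markov's inequality on an interval of unit length. The point `x` cuts the interval into two, the
longer of which has length at least `1 / 2` and `x` as an end point. -/
theorem abs_eval_derivative_le {n : ℕ} {P : ℝ[X]} {M u : ℝ} (hM : 0 < M) (hP : P.degree ≤ n)
    (h : ∀ x ∈ Set.Icc u (u + 1), |P.eval x| ≤ M) {x : ℝ} (hx : x ∈ Set.Icc u (u + 1)) :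
    |P.derivative.eval x| ≤ 4 * n ^ 2 * M := by
  have key : ∀ t : ℝ, |t| = 1 / 4 → (∀ y ∈ Set.Icc (-1 : ℝ) 1, x + t * (1 - y) ∈ Set.Icc u (u + 1)) →
      |P.derivative.eval x| ≤ 4 * n ^ 2 * M := by
    intro t ht hy
    have hdeg : (P.comp (C (x + t) - C t * X)).degree ≤ n := by
      rw [← natDegree_le_iff_degree_le] at hP ⊢
      refine natDegree_comp_le.trans ?_
      have : (C (x + t) - C t * X : ℝ[X]).natDegree ≤ 1 := by
        compute_degree
      calc _ ≤ n * 1 := Nat.mul_le_mul hP this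
        _ = n := mul_one n
    have h1 := abs_eval_one_derivative_le hM hdeg (by
      intro y hy'
      have := h _ (hy y hy')
      rw [eval_comp]
      simpa [show x + t - t * y = x + t * (1 - y) by ring] using this)
    rw [derivative_comp] at h1
    simp only [derivative_sub, derivative_C, derivative_mul, derivative_X, eval_mul, eval_comp,
      eval_sub, eval_C, eval_X, zero_mul, mul_one, zero_add, zero_sub, eval_neg, abs_mul,
      abs_neg, ht, add_sub_cancel_right] at h1
    linarith
  by_cases hxu : x ≤ u + 1 / 2
  · refine key (1 / 4) (by norm_num) fun y hy => ?_
    have h1 := hy.1; have h2 := hy.2; have h3 := hx.1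
    constructor <;> linarith
  · refine key (-(1 / 4)) (by norm_num) fun y hy => ?_
    push Not at hxu
    have h1 := hy.1; have h2 := hy.2; have h3 := hx.2
    constructor <;> linarith

open Polynomial in
/-- Markov's inequality for complex polynomials, as a Lipschitz bound. -/
theorem norm_eval_sub_eval_le {n : ℕ} {P : ℂ[X]} {M u : ℝ} (hM : 0 < M) (hP : P.degree ≤ n)
    (h : ∀ x ∈ Set.Icc u (u + 1), ‖P.eval (x : ℂ)‖ ≤ M) {x y : ℝ}
    (hx : x ∈ Set.Icc u (u + 1)) (hy : y ∈ Set.Icc u (u + 1)) :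
    ‖P.eval (x : ℂ) - P.eval (y : ℂ)‖ ≤ 4 * n ^ 2 * M * |x - y| := by
  -- after multiplication by a unit, the difference is the difference of the values of a real
  -- polynomial
  obtain ⟨c, hc1, hc⟩ : ∃ c : ℂ, ‖c‖ = 1 ∧
      ‖P.eval (x : ℂ) - P.eval (y : ℂ)‖ = (c * (P.eval (x : ℂ) - P.eval (y : ℂ))).re := by
    obtain ⟨c, hc1, hc⟩ := RCLike.exists_norm_eq_mul_self (P.eval (x : ℂ) - P.eval (y : ℂ))
    exact ⟨c, hc1, by rw [← hc]; simp⟩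
  let Q : ℝ[X] := ∑ k ∈ Finset.range (n + 1), C ((c * P.coeff k).re) * X ^ k
  have hQdeg : Q.degree ≤ n := by
    refine (degree_sum_le _ _).trans (Finset.sup_le fun k hk => ?_)
    refine (degree_C_mul_X_pow_le _ _).trans ?_
    exact_mod_cast Nat.lt_succ_iff.mp (Finset.mem_range.mp hk)
  have hQ : ∀ t : ℝ, Q.eval t = (c * P.eval (t : ℂ)).re := by
    intro t
    rw [eval_eq_sum_range' (n := n + 1) (Nat.lt_succ_of_le (natDegree_le_iff_degree_le.mpr hP)),
      Finset.mul_sum, Complex.re_sum, eval_finsetSum]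
    refine Finset.sum_congr rfl fun k _ => ?_
    rw [eval_C_mul, eval_pow, eval_X, ← mul_assoc, ← Complex.ofReal_pow, Complex.re_mul_ofReal]
  have hQb : ∀ t ∈ Set.Icc u (u + 1), |Q.eval t| ≤ M := by
    intro t ht
    rw [hQ]
    refine (Complex.abs_re_le_norm _).trans ?_
    rw [norm_mul, hc1, one_mul]
    exact h t ht
  have hlip := (convex_Icc u (u + 1)).norm_image_sub_le_of_norm_hasDerivWithin_le
    (f := fun t => Q.eval t) (f' := fun t => Q.derivative.eval t) (C := 4 * n ^ 2 * M)
    (fun t _ => (Q.hasDerivAt t).hasDerivWithinAt)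
    (fun t ht => by rw [Real.norm_eq_abs]; exact abs_eval_derivative_le hM hQdeg hQb ht) hy hx
  rw [hc, mul_sub, Complex.sub_re, ← hQ, ← hQ]
  exact (le_abs_self _).trans hlip

/-- A tail of the exponential series, estimated by Rankin's trick: the `k`-th term with `k ≥ N`
carries the factor `e^{2(k - N)} ≥ 1`. -/
theorem norm_exp_sub_sum_range_le {z : ℂ} {R : ℝ} (hz : ‖z‖ ≤ R) (N : ℕ) :
    ‖Complex.exp z - ∑ k ∈ Finset.range N, z ^ k / (k.factorial : ℂ)‖ ≤
      Real.exp (-2 * N) * Real.exp (Real.exp 2 * R) := by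
  have hs : HasSum (fun k : ℕ => z ^ k / (k.factorial : ℂ)) (Complex.exp z) := by
    rw [Complex.exp_eq_exp_ℂ]
    exact NormedSpace.expSeries_div_hasSum_exp z
  have hr : HasSum (fun k : ℕ => (Real.exp 2 * R) ^ k / (k.factorial : ℝ))
      (Real.exp (Real.exp 2 * R)) := by
    rw [Real.exp_eq_exp_ℝ]
    exact NormedSpace.expSeries_div_hasSum_exp _
  have hR : 0 ≤ R := (norm_nonneg z).trans hz
  have h1 := (hasSum_nat_add_iff' N).mpr hs
  have h2 : Summable (fun k : ℕ => (Real.exp 2 * R) ^ (k + N) / ((k + N).factorial : ℝ)) :=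
    (summable_nat_add_iff N).mpr hr.summable
  rw [← h1.tsum_eq]
  have hle : ∀ k : ℕ, ‖z ^ (k + N) / ((k + N).factorial : ℂ)‖ ≤
      Real.exp (-2 * N) * ((Real.exp 2 * R) ^ (k + N) / ((k + N).factorial : ℝ)) := by
    intro k
    rw [norm_div, norm_pow, Complex.norm_natCast, ← mul_div_assoc]
    gcongr
    calc ‖z‖ ^ (k + N) ≤ R ^ (k + N) := by gcongr
      _ ≤ Real.exp (2 * k) * R ^ (k + N) :=
          le_mul_of_one_le_left (by positivity) (Real.one_le_exp (by positivity))
      _ = Real.exp (-2 * N) * (Real.exp 2 * R) ^ (k + N) := by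
          rw [mul_pow, ← mul_assoc, ← Real.exp_nat_mul, ← Real.exp_add]
          congr 2
          push_cast
          ring
  refine (tsum_of_norm_bounded (h2.mul_left _).hasSum hle).trans ?_
  rw [tsum_mul_left]
  gcongr
  rw [← hr.tsum_eq, ← hr.summable.sum_add_tsum_nat_add N]
  have : 0 ≤ ∑ k ∈ Finset.range N, (Real.exp 2 * R) ^ k / (k.factorial : ℝ) :=
    Finset.sum_nonneg fun k _ => by positivity
  linarith

/-- The exponential `x ↦ e^{-z s(x)}` as an element of `C(X, ℂ)`, where `s : X → ℂ` is thought of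
as the inclusion of a compact set of the complex plane. -/
noncomputable def expFun {X : Type*} [TopologicalSpace X] (s : C(X, ℂ)) (z : ℂ) : C(X, ℂ) :=
  ⟨fun x => Complex.exp (-z * s x), by fun_prop⟩

@[simp] theorem expFun_apply {X : Type*} [TopologicalSpace X] (s : C(X, ℂ)) (z : ℂ) (x : X) :
    expFun s z x = Complex.exp (-z * s x) := rfl

variable {X : Type*} [TopologicalSpace X] [CompactSpace X]

theorem norm_expFun_le {s : C(X, ℂ)} {α : ℝ} (hα : ∀ x, α ≤ (s x).re) {u : ℝ} (hu : 0 ≤ u) :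
    ‖expFun s u‖ ≤ Real.exp (-α * u) := by
  refine (ContinuousMap.norm_le _ (Real.exp_pos _).le).mpr fun x => ?_
  rw [expFun_apply, Complex.norm_exp]
  gcongr
  have := mul_le_mul_of_nonneg_left (hα x) hu
  simp
  linarith

open Polynomial in
/-- The Taylor polynomial of degree about `u` of `x ↦ φ(e^{-xs})` at `u` is exponentially close to
this function on `[u, u + 1]`. -/
theorem exists_polynomial_approx {s : C(X, ℂ)} (hs : ∀ x, 0 ≤ (s x).re)
    (φ : C(X, ℂ) →L[ℂ] ℂ) :
    ∃ C : ℝ, 0 < C ∧ ∀ u : ℝ, 0 ≤ u → ∃ P : ℂ[X], P.degree ≤ ⌈u⌉₊ ∧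
      ∀ x ∈ Set.Icc u (u + 1), ‖φ (expFun s (x : ℂ)) - P.eval (x : ℂ)‖ ≤ C * Real.exp (-2 * u) := by
  refine ⟨(‖φ‖ + 1) * Real.exp (Real.exp 2 * ‖s‖), by positivity, fun u hu => ?_⟩
  set N := ⌈u⌉₊ with hN
  have hNu : u ≤ N := Nat.le_ceil u
  refine ⟨∑ k ∈ Finset.range N, C (φ (expFun s u * (-s) ^ k) / (k.factorial : ℂ)) *
    (Polynomial.X - C (u : ℂ)) ^ k, ?_, fun x hx => ?_⟩
  · refine (degree_sum_le _ _).trans (Finset.sup_le fun k hk => ?_)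
    refine (degree_mul_le _ _).trans ?_
    refine (add_le_add degree_C_le (degree_pow_le_of_le k (degree_X_sub_C_le _))).trans ?_
    rw [zero_add, mul_one]
    exact_mod_cast (Finset.mem_range.mp hk).le
  · have hxu : |x - u| ≤ 1 := by
      rw [abs_le]; constructor <;> linarith [hx.1, hx.2]
    have heq : φ (expFun s (x : ℂ)) - (∑ k ∈ Finset.range N,
        C (φ (expFun s u * (-s) ^ k) / (k.factorial : ℂ)) * (Polynomial.X - C (u : ℂ)) ^ k).eval (x : ℂ) =
        φ (expFun s (x : ℂ) - ∑ k ∈ Finset.range N,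
          (((x - u : ℝ) : ℂ) ^ k / (k.factorial : ℂ)) • (expFun s u * (-s) ^ k)) := by
      rw [map_sub, map_sum, eval_finsetSum]
      congr 1
      refine Finset.sum_congr rfl fun k _ => ?_
      simp only [map_smul, smul_eq_mul, eval_mul, eval_C, eval_pow, eval_sub, eval_X]
      push_cast
      ring
    rw [heq]
    have hnorm : ‖expFun s (x : ℂ) - ∑ k ∈ Finset.range N,
          (((x - u : ℝ) : ℂ) ^ k / (k.factorial : ℂ)) • (expFun s u * (-s) ^ k)‖ ≤
        Real.exp (-2 * u) * Real.exp (Real.exp 2 * ‖s‖) := by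
      refine (ContinuousMap.norm_le _ (by positivity)).mpr fun t => ?_
      have h1 : (expFun s (x : ℂ) - ∑ k ∈ Finset.range N,
          (((x - u : ℝ) : ℂ) ^ k / (k.factorial : ℂ)) • (expFun s u * (-s) ^ k)) t =
          expFun s u t * (Complex.exp (-((x - u : ℝ) : ℂ) * s t) -
            ∑ k ∈ Finset.range N, (-((x - u : ℝ) : ℂ) * s t) ^ k / (k.factorial : ℂ)) := by
        simp only [ContinuousMap.sub_apply, ContinuousMap.coe_sum, Finset.sum_apply,
          ContinuousMap.smul_apply, ContinuousMap.mul_apply, ContinuousMap.pow_apply,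
          ContinuousMap.neg_apply, expFun_apply, mul_sub, Finset.mul_sum, ← Complex.exp_add,
          smul_eq_mul]
        congr 1
        · congr 1
          push_cast
          ring
        · refine Finset.sum_congr rfl fun k _ => ?_
          rw [neg_mul_comm, mul_pow]
          ring
      rw [h1, norm_mul]
      have h2 : ‖expFun s u t‖ ≤ 1 := by
        refine ((expFun s (u : ℂ)).norm_coe_le_norm t).trans ?_
        simpa using norm_expFun_le hs hu
      have h3 : ‖-((x - u : ℝ) : ℂ) * s t‖ ≤ ‖s‖ := by
        rw [norm_mul, norm_neg, Complex.norm_real, Real.norm_eq_abs]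
        calc |x - u| * ‖s t‖ ≤ 1 * ‖s‖ := by gcongr; exact s.norm_coe_le_norm t
          _ = ‖s‖ := one_mul _
      have h4 := norm_exp_sub_sum_range_le h3 N
      calc _ ≤ 1 * (Real.exp (-2 * N) * Real.exp (Real.exp 2 * ‖s‖)) := by gcongr
        _ ≤ _ := by
          rw [one_mul]
          gcongr ?_ * _
          apply Real.exp_le_exp.mpr
          linarith
    calc _ ≤ ‖φ‖ * (Real.exp (-2 * u) * Real.exp (Real.exp 2 * ‖s‖)) := φ.le_opNorm_of_le hnorm
      _ ≤ (‖φ‖ + 1) * (Real.exp (-2 * u) * Real.exp (Real.exp 2 * ‖s‖)) := by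
          gcongr; linarith
      _ = _ := by ring

/-- On intervals of unit length the function `u ↦ φ(e^{-us})` varies slowly: it is nearly constant
at scale `u⁻²`, by Markov's inequality for its Taylor polynomials of degree about `u`. -/
theorem exists_slow_variation {s : C(X, ℂ)} (hs : ∀ x, 0 ≤ (s x).re) (φ : C(X, ℂ) →L[ℂ] ℂ) :
    ∃ C : ℝ, 0 < C ∧ ∀ u M : ℝ, 1 ≤ u → 0 ≤ M →
      (∀ x ∈ Set.Icc u (u + 1), ‖φ (expFun s (x : ℂ))‖ ≤ M) →
      ∀ x ∈ Set.Icc u (u + 1), ∀ y ∈ Set.Icc u (u + 1),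
        ‖φ (expFun s (x : ℂ)) - φ (expFun s (y : ℂ))‖ ≤
          16 * u ^ 2 * (M + C * Real.exp (-2 * u)) * |x - y| + C * Real.exp (-2 * u) := by
  obtain ⟨C, hC, h⟩ := exists_polynomial_approx hs φ
  refine ⟨2 * C, by positivity, fun u M hu hM hb x hx y hy => ?_⟩
  obtain ⟨P, hdeg, hP⟩ := h u (by linarith)
  have hpos : 0 < C * Real.exp (-2 * u) := by positivity
  have hPb : ∀ t ∈ Set.Icc u (u + 1), ‖P.eval (t : ℂ)‖ ≤ M + C * Real.exp (-2 * u) := by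
    intro t ht
    have h1 := norm_sub_norm_le (P.eval (t : ℂ)) (φ (expFun s (t : ℂ)))
    rw [norm_sub_rev] at h1
    linarith [hP t ht, hb t ht]
  have h1 := norm_eval_sub_eval_le (by linarith) hdeg hPb hx hy
  have hceil : ((⌈u⌉₊ : ℕ) : ℝ) ≤ 2 * u := by
    linarith [(Nat.ceil_lt_add_one (by linarith : 0 ≤ u)).le]
  have h2 : 4 * ((⌈u⌉₊ : ℕ) : ℝ) ^ 2 * (M + C * Real.exp (-2 * u)) * |x - y| ≤
      16 * u ^ 2 * (M + 2 * C * Real.exp (-2 * u)) * |x - y| := by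
    have : ((⌈u⌉₊ : ℕ) : ℝ) ^ 2 ≤ (2 * u) ^ 2 := by gcongr
    gcongr ?_ * ?_ * _
    · linarith
    · linarith
  have h3 : φ (expFun s (x : ℂ)) - φ (expFun s (y : ℂ)) =
      (φ (expFun s (x : ℂ)) - P.eval (x : ℂ)) + (P.eval (x : ℂ) - P.eval (y : ℂ)) +
      -(φ (expFun s (y : ℂ)) - P.eval (y : ℂ)) := by ring
  rw [h3]
  refine (norm_add₃_le).trans ?_
  rw [norm_neg]
  linarith [hP x hx, hP y hy]

end SlowVariation

/-! ### Increments over short intervals -/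

section ShortIntervals

variable {κ : ℝ}

theorem tendsto_div_pow_atTop_nhdsNE {κ : ℝ} (hκ : 0 < κ) {n : ℕ} (hn : n ≠ 0) :
    Tendsto (fun a : ℝ => κ / a ^ n) atTop (𝓝[≠] 0) := by
  refine tendsto_nhdsWithin_iff.mpr ⟨tendsto_const_nhds.div_atTop (tendsto_pow_atTop hn), ?_⟩
  filter_upwards [eventually_gt_atTop 0] with a ha
  have : 0 < κ / a ^ n := by positivity
  exact this.ne'

theorem tendsto_sq_mul_exp_sub_one (hκ : 0 < κ) :
    Tendsto (fun a : ℝ => a ^ 2 * (Real.exp (κ / a ^ 2) - 1)) atTop (𝓝 κ) := by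
  have h := (hasDerivAt_iff_tendsto_slope_zero.mp (Real.hasDerivAt_exp 0)).comp
    (tendsto_div_pow_atTop_nhdsNE hκ two_ne_zero)
  have h2 := h.const_mul κ
  simp only [Real.exp_zero, mul_one] at h2
  refine h2.congr' ?_
  filter_upwards [eventually_gt_atTop 0] with a ha
  simp only [Function.comp, smul_eq_mul, zero_add]
  field_simp

theorem tendsto_sq_mul_ratio_pow_sub_one (hκ : 0 < κ) (i : ℕ) :
    Tendsto (fun a : ℝ => a ^ 2 * ((a / (a + κ / a ^ 2)) ^ i - 1)) atTop (𝓝 0) := by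
  have hd : HasDerivAt (fun x : ℝ => ((1 + x)⁻¹) ^ i) ((i : ℝ) * ((1 + 0)⁻¹) ^ (i - 1) *
      (-1 / (1 + 0) ^ 2)) 0 := by
    have h1 : HasDerivAt (fun x : ℝ => 1 + x) 1 0 := (hasDerivAt_id (0 : ℝ)).const_add 1
    exact (h1.fun_inv (by norm_num)).fun_pow i
  have h := (hasDerivAt_iff_tendsto_slope_zero.mp hd).comp
    (tendsto_div_pow_atTop_nhdsNE hκ three_ne_zero)
  have h3 : Tendsto (fun a : ℝ => κ / a) atTop (𝓝 0) := tendsto_const_nhds.div_atTop tendsto_id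
  have h2 := h3.mul h
  rw [zero_mul] at h2
  refine h2.congr' ?_
  filter_upwards [eventually_gt_atTop 0] with a ha
  simp only [Function.comp, smul_eq_mul, zero_add, add_zero, inv_one, one_pow]
  have h4 : (1 + κ / a ^ 3)⁻¹ = a / (a + κ / a ^ 2) := by
    field_simp
  rw [h4]
  field_simp

theorem tendsto_ratio (hκ : 0 < κ) :
    Tendsto (fun a : ℝ => a / (a + κ / a ^ 2)) atTop (𝓝 1) := by
  have h3 : Tendsto (fun a : ℝ => (1 + κ / a ^ 3)⁻¹) atTop (𝓝 ((1 + 0)⁻¹)) :=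
    (((tendsto_div_pow_atTop_nhdsNE hκ three_ne_zero).mono_right nhdsWithin_le_nhds).const_add
      1).inv₀ (by norm_num)
  rw [add_zero, inv_one] at h3
  refine h3.congr' ?_
  filter_upwards [eventually_gt_atTop 0] with a ha
  field_simp

theorem tendsto_exp_div_sq (hκ : 0 < κ) :
    Tendsto (fun a : ℝ => Real.exp (κ / a ^ 2)) atTop (𝓝 1) := by
  have := (Real.continuous_exp.tendsto 0).comp
    ((tendsto_div_pow_atTop_nhdsNE hκ two_ne_zero).mono_right nhdsWithin_le_nhds)
  simpa [Function.comp_def] using this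

/-- The increment of `e^t / t^(i+1)` over `[a, a + κ / a²]`, on the scale `e^a / a³`. -/
theorem tendsto_increment_exp_div_pow (hκ : 0 < κ) (i : ℕ) :
    Tendsto (fun a : ℝ => (Real.exp (a + κ / a ^ 2) / (a + κ / a ^ 2) ^ (i + 1) -
      Real.exp a / a ^ (i + 1)) * (a ^ 3 * Real.exp (-a))) atTop (𝓝 (if i = 0 then κ else 0)) := by
  have h1 := ((tendsto_sq_mul_exp_sub_one hκ).mul ((tendsto_ratio hκ).pow (i + 1))).add
    (tendsto_sq_mul_ratio_pow_sub_one hκ (i + 1))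
  have h0 : Tendsto (fun a : ℝ => 1 / a ^ i) atTop (𝓝 (if i = 0 then 1 else 0)) := by
    split_ifs with hi
    · simp [hi]
    · exact tendsto_const_nhds.div_atTop (tendsto_pow_atTop hi)
  have h2 := h0.mul h1
  rw [one_pow, mul_one, add_zero, ite_mul, one_mul, zero_mul] at h2
  refine h2.congr' ?_
  filter_upwards [eventually_gt_atTop 0] with a ha
  have hb : 0 < a + κ / a ^ 2 := by positivity
  rw [Real.exp_add, Real.exp_neg, div_pow]
  have := Real.exp_pos a
  generalize Real.exp (κ / a ^ 2) = e
  generalize a + κ / a ^ 2 = b at *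
  field_simp
  ring

/-- From an asymptotic expansion of `g x` in terms `x / (log x)^j` with error
`O(x / (log x)^4)` one reads off the asymptotics of the increments of `g` over the short intervals
`[e^a, e^(a + κ / a²)]`: only the term `j = 1` contributes. -/
theorem tendsto_increment {g : ℝ → ℂ} {n q : ℕ} {c : ℕ → ℂ} (hq : 4 ≤ q) (hκ : 0 < κ)
    (h : (fun x : ℝ => g x - ∑ j ∈ Finset.range n, c j * (x : ℂ) / (Real.log x : ℂ) ^ (j + 1))
      =O[atTop] fun x : ℝ => x / Real.log x ^ q) (hn : 0 < n) :
    Tendsto (fun a : ℝ => (g (Real.exp (a + κ / a ^ 2)) - g (Real.exp a)) *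
      ((a ^ 3 * Real.exp (-a) : ℝ) : ℂ)) atTop (𝓝 (c 0 * κ)) := by
  set e : ℝ → ℂ := fun t => g (Real.exp t) - ∑ j ∈ Finset.range n,
    c j * ((Real.exp t / t ^ (j + 1) : ℝ) : ℂ) with he
  have hb : Tendsto (fun a : ℝ => a + κ / a ^ 2) atTop atTop :=
    tendsto_atTop_mono' _ (by
      filter_upwards [eventually_gt_atTop 0] with a ha
      have : 0 < κ / a ^ 2 := by positivity
      exact (lt_add_of_pos_right a this).le) tendsto_id
  have hee : Tendsto (fun t : ℝ => e t * ((t ^ 3 * Real.exp (-t) : ℝ) : ℂ)) atTop (𝓝 0) := by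
    have h1 : e =O[atTop] fun t : ℝ => Real.exp t / t ^ q := by
      have := h.comp_tendsto Real.tendsto_exp_atTop
      refine (this.congr (fun t => ?_) (fun t => ?_))
      · simp only [Function.comp, he, Real.log_exp]
        congr 1
        refine Finset.sum_congr rfl fun j _ => ?_
        push_cast
        ring
      · simp [Function.comp]
    have h2 : (fun t : ℝ => ((t ^ 3 * Real.exp (-t) : ℝ) : ℂ)) =O[atTop]
        fun t : ℝ => t ^ 3 * Real.exp (-t) := by
      refine IsBigO.of_bound 1 (Eventually.of_forall fun t => ?_)
      rw [Complex.norm_real, one_mul]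
    refine (h1.mul h2).trans_tendsto ?_
    have h3 : Tendsto (fun t : ℝ => 1 / t ^ (q - 3)) atTop (𝓝 0) :=
      tendsto_const_nhds.div_atTop (tendsto_pow_atTop (by omega))
    refine h3.congr' ?_
    filter_upwards [eventually_gt_atTop 0] with t ht
    have : t ^ q = t ^ (q - 3) * t ^ 3 := by rw [← pow_add]; congr 1; omega
    rw [this, Real.exp_neg]
    have := Real.exp_pos t
    field_simp
  -- the error term at the upper end point
  have heb : Tendsto (fun a : ℝ => e (a + κ / a ^ 2) * ((a ^ 3 * Real.exp (-a) : ℝ) : ℂ)) atTop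
      (𝓝 0) := by
    have h1 := (hee.comp hb).mul ((Complex.continuous_ofReal.tendsto _).comp
      (((tendsto_ratio hκ).pow 3).mul (tendsto_exp_div_sq hκ)))
    rw [zero_mul] at h1
    refine h1.congr' ?_
    filter_upwards [eventually_gt_atTop 0] with a ha
    simp only [Function.comp]
    rw [mul_assoc, ← Complex.ofReal_mul]
    congr 2
    have hb : 0 < a + κ / a ^ 2 := by positivity
    rw [neg_add, Real.exp_add, Real.exp_neg (κ / a ^ 2), div_pow]
    have := Real.exp_pos (κ / a ^ 2)
    generalize Real.exp (κ / a ^ 2) = e at *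
    generalize a + κ / a ^ 2 = b at *
    field_simp
  have hmain : Tendsto (fun a : ℝ => ∑ j ∈ Finset.range n, c j *
      (((Real.exp (a + κ / a ^ 2) / (a + κ / a ^ 2) ^ (j + 1) -
      Real.exp a / a ^ (j + 1)) * (a ^ 3 * Real.exp (-a)) : ℝ) : ℂ)) atTop
      (𝓝 (∑ j ∈ Finset.range n, c j * ((if j = 0 then κ else 0 : ℝ) : ℂ))) :=
    tendsto_finsetSum _ fun j _ => ((Complex.continuous_ofReal.tendsto _).comp
      (tendsto_increment_exp_div_pow hκ j)).const_mul _
  have hsum : ∑ j ∈ Finset.range n, c j * ((if j = 0 then κ else 0 : ℝ) : ℂ) = c 0 * κ := by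
    rw [Finset.sum_eq_single_of_mem 0 (Finset.mem_range.mpr hn)]
    · simp
    · intro j _ hj
      simp [hj]
  rw [hsum] at hmain
  have htot := (hmain.add heb).sub hee
  rw [add_zero, sub_zero] at htot
  refine htot.congr fun a => ?_
  simp only [he]
  simp only [Complex.ofReal_mul, Complex.ofReal_sub, ← mul_assoc, ← Finset.sum_mul, mul_sub,
    Finset.sum_sub_distrib]
  ring

end ShortIntervals

/-! ### Decay of functionals along the exponentials -/

section Decay

/-- The primes `p` with `e^a < p ≤ e^(a + κ / a²)`. -/
noncomputable def shortPrimes (κ a : ℝ) : Finset ℕ :=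
  (Finset.Ioc ⌊Real.exp a⌋₊ ⌊Real.exp (a + κ / a ^ 2)⌋₊).filter Nat.Prime

/-- Near-orthogonality of the coefficient functions `a j` on a finite set `I`, applied to the
combination `∑_j a_j ρ_j` with almost constant `ρ_j ≈ v_j`: correlating with `a_{j₀}` isolates
`v_{j₀}`. -/
theorem mul_le_norm_correlation {m : ℕ} {a ρ : Fin m → ℕ → ℂ} {v : Fin m → ℂ} {I : Finset ℕ}
    {j₀ : Fin m} {M δ U Lo ε : ℝ} (hM : ∀ j, ‖v j‖ ≤ M) (hj₀ : ‖v j₀‖ = M) (hδ : 0 ≤ δ)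
    (hε : 0 ≤ ε)
    (hρ : ∀ j, ∀ p ∈ I, ‖ρ j p - v j‖ ≤ δ) (hU : ∀ j, ∑ p ∈ I, ‖a j p‖ ^ 2 ≤ U)
    (hLo : Lo ≤ ∑ p ∈ I, ‖a j₀ p‖ ^ 2)
    (hoff : ∀ j, j ≠ j₀ → ‖∑ p ∈ I, a j p * (starRingEnd ℂ) (a j₀ p)‖ ≤ ε) :
    M * Lo ≤ ‖∑ p ∈ I, (starRingEnd ℂ) (a j₀ p) * ∑ j, a j p * ρ j p‖ + M * (m * ε) +
      δ * (m * U) := by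
  have hM0 : 0 ≤ M := (norm_nonneg _).trans (hM j₀)
  have h1 : ∑ p ∈ I, (starRingEnd ℂ) (a j₀ p) * ∑ j, a j p * ρ j p =
      ∑ j, v j * ∑ p ∈ I, a j p * (starRingEnd ℂ) (a j₀ p) +
      ∑ j, ∑ p ∈ I, a j p * (starRingEnd ℂ) (a j₀ p) * (ρ j p - v j) := by
    rw [← Finset.sum_add_distrib]
    simp only [Finset.mul_sum, ← Finset.sum_add_distrib]
    rw [Finset.sum_comm]
    refine Finset.sum_congr rfl fun j _ => Finset.sum_congr rfl fun p _ => ?_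
    ring
  have h2 : ‖∑ j, ∑ p ∈ I, a j p * (starRingEnd ℂ) (a j₀ p) * (ρ j p - v j)‖ ≤ δ * (m * U) := by
    have : ∀ j, ‖∑ p ∈ I, a j p * (starRingEnd ℂ) (a j₀ p) * (ρ j p - v j)‖ ≤ δ * U := by
      intro j
      calc _ ≤ ∑ p ∈ I, ‖a j p * (starRingEnd ℂ) (a j₀ p) * (ρ j p - v j)‖ := norm_sum_le _ _
        _ ≤ ∑ p ∈ I, δ * ((‖a j p‖ ^ 2 + ‖a j₀ p‖ ^ 2) / 2) := by
            refine Finset.sum_le_sum fun p hp => ?_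
            rw [norm_mul, norm_mul, RCLike.norm_conj, mul_comm]
            refine mul_le_mul (hρ j p hp) ?_ (by positivity) hδ
            linarith [two_mul_le_add_sq ‖a j p‖ ‖a j₀ p‖]
        _ = δ * ((∑ p ∈ I, ‖a j p‖ ^ 2 + ∑ p ∈ I, ‖a j₀ p‖ ^ 2) / 2) := by
            rw [← Finset.mul_sum, ← Finset.sum_div, Finset.sum_add_distrib]
        _ ≤ δ * U := by
            gcongr
            linarith [hU j, hU j₀]
    calc _ ≤ ∑ _j : Fin m, δ * U := (norm_sum_le _ _).trans (Finset.sum_le_sum fun j _ => this j)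
      _ = δ * (m * U) := by simp; ring
  have h3 : M * Lo ≤ ‖v j₀ * ∑ p ∈ I, a j₀ p * (starRingEnd ℂ) (a j₀ p)‖ := by
    have : ∑ p ∈ I, a j₀ p * (starRingEnd ℂ) (a j₀ p) = ((∑ p ∈ I, ‖a j₀ p‖ ^ 2 : ℝ) : ℂ) := by
      push_cast
      exact Finset.sum_congr rfl fun p _ => Complex.mul_conj' _
    rw [norm_mul, hj₀, this, Complex.norm_real, Real.norm_eq_abs]
    gcongr
    exact hLo.trans (le_abs_self _)
  have h4 : ‖∑ j ∈ Finset.univ.erase j₀, v j * ∑ p ∈ I, a j p * (starRingEnd ℂ) (a j₀ p)‖ ≤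
      M * (m * ε) := by
    calc _ ≤ ∑ j ∈ Finset.univ.erase j₀, M * ε := by
          refine (norm_sum_le _ _).trans (Finset.sum_le_sum fun j hj => ?_)
          rw [norm_mul]
          exact mul_le_mul (hM j) (hoff j (Finset.ne_of_mem_erase hj)) (norm_nonneg _) hM0
      _ ≤ ∑ _j : Fin m, M * ε :=
          Finset.sum_le_sum_of_subset_of_nonneg (Finset.erase_subset _ _)
            fun _ _ _ => mul_nonneg hM0 hε
      _ = M * (m * ε) := by simp; ring
  rw [← Finset.add_sum_erase _ _ (Finset.mem_univ j₀)] at h1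
  have h5 := congrArg (fun z => v j₀ * ∑ p ∈ I, a j₀ p * (starRingEnd ℂ) (a j₀ p) - z) h1
  have h6 : v j₀ * ∑ p ∈ I, a j₀ p * (starRingEnd ℂ) (a j₀ p) =
      (∑ p ∈ I, (starRingEnd ℂ) (a j₀ p) * ∑ j, a j p * ρ j p) +
      -(∑ j ∈ Finset.univ.erase j₀, v j * ∑ p ∈ I, a j p * (starRingEnd ℂ) (a j₀ p)) +
      -(∑ j, ∑ p ∈ I, a j p * (starRingEnd ℂ) (a j₀ p) * (ρ j p - v j)) := by
    rw [h1]; ring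
  rw [h6] at h3
  refine h3.trans (norm_add₃_le.trans ?_)
  rw [norm_neg, norm_neg]
  linarith

theorem continuous_expFun {X : Type*} [TopologicalSpace X] (s : C(X, ℂ)) :
    Continuous fun x : ℝ => expFun s (x : ℂ) := by
  refine ContinuousMap.continuous_of_continuous_uncurry _ ?_
  simp only [Function.uncurry_def, expFun_apply]
  fun_prop

variable {X : Type*} [TopologicalSpace X] [CompactSpace X]

/-- If `∑_j a_j(p) ρ_j(log p)` with `ρ_j(x) = φ_j(e^{-xs})` is absolutely summable over the primes,
and the `a_j` are asymptotically orthogonal on short intervals, then `ρ_j(x) = O(e^{-βx})` for all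
`β < 1`. Otherwise, near a point at which some `|ρ_{j₀}|` is maximal on `[u, u + 1]`, the
`ρ_j` may be treated as constants, and correlating with the conjugate of `a_{j₀}` over the
primes there contradicts the summability. -/
theorem eventually_norm_le_exp_neg {m : ℕ} {a : Fin m → ℕ → ℂ} {c : Fin m → ℝ} {s : C(X, ℂ)}
    {φ : Fin m → C(X, ℂ) →L[ℂ] ℂ} {N : ℕ} {T β : ℝ}
    (hram : ∀ ε : ℝ, 0 < ε → ∀ j, ∃ C : ℝ, ∀ n : ℕ, 1 ≤ n → ‖a j n‖ ≤ C * (n : ℝ) ^ ε)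
    (hc : ∀ k, 0 < c k)
    (hdiag : ∀ k κ, 0 < κ → Tendsto (fun t : ℝ =>
      (∑ p ∈ shortPrimes κ t, ‖a k p‖ ^ 2) * (t ^ 3 * Real.exp (-t))) atTop (𝓝 (c k * κ)))
    (hoff : ∀ j k κ, j ≠ k → 0 < κ → Tendsto (fun t : ℝ =>
      ‖∑ p ∈ shortPrimes κ t, a j p * (starRingEnd ℂ) (a k p)‖ * (t ^ 3 * Real.exp (-t)))
      atTop (𝓝 0))
    (hs : ∀ x, 0 ≤ (s x).re)
    (hT : ∀ F : Finset ℕ, (∀ p ∈ F, p.Prime ∧ N < p) →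
      ∑ p ∈ F, ‖∑ j, a j p * φ j (expFun s (Real.log p : ℝ))‖ ≤ T)
    (hβ : β < 1) :
    ∀ᶠ u : ℝ in atTop, ∀ j, ∀ x ∈ Set.Icc u (u + 1),
      ‖φ j (expFun s (x : ℂ))‖ ≤ Real.exp (-β * u) := by
  rcases Nat.eq_zero_or_pos m with rfl | hm
  · exact Eventually.of_forall fun u j => j.elim0
  have : Nonempty (Fin m) := ⟨⟨0, hm⟩⟩
  have hT0 : 0 ≤ T := by simpa using hT ∅ (by simp)
  obtain ⟨k₁, hk₁⟩ := Finite.exists_min c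
  obtain ⟨k₂, hk₂⟩ := Finite.exists_max c
  set cm := c k₁
  set cM := c k₂
  have hcm : 0 < cm := hc k₁
  have hcM : 0 < cM := hc k₂
  have hm' : (0 : ℝ) < m := by exact_mod_cast hm
  choose C hC hvar using fun j => exists_slow_variation hs (φ j)
  choose Cr hCr using hram ((1 - β) / 2) (by linarith)
  -- the length of the short intervals, small enough for the freezing error to be negligible
  set κ := min (1 / 2) (cm / (66 * 8 * m * cM)) with hκdef
  have hκ : 0 < κ := by positivity
  have hκ2 : κ ≤ 1 / 2 := min_le_left _ _
  have hκ3 : 66 * m * cM * κ ≤ cm / 8 := by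
    calc 66 * m * cM * κ ≤ 66 * m * cM * (cm / (66 * 8 * m * cM)) := by
          gcongr; exact min_le_right _ _
      _ = cm / 8 := by field_simp
  have hev : ∀ᶠ t : ℝ in atTop, (∀ k, c k * κ / 2 ≤
        (∑ p ∈ shortPrimes κ t, ‖a k p‖ ^ 2) * (t ^ 3 * Real.exp (-t)) ∧
        (∑ p ∈ shortPrimes κ t, ‖a k p‖ ^ 2) * (t ^ 3 * Real.exp (-t)) ≤ 2 * (c k * κ)) ∧
      ∀ j k, j ≠ k → ‖∑ p ∈ shortPrimes κ t, a j p * (starRingEnd ℂ) (a k p)‖ *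
        (t ^ 3 * Real.exp (-t)) ≤ κ * cm / (8 * m) := by
    refine (eventually_all.mpr fun k => ?_).and
      (eventually_all.mpr fun j => eventually_all.mpr fun k => ?_)
    · have hpos : 0 < c k * κ := mul_pos (hc k) hκ
      exact ((hdiag k κ hκ).eventually_const_le (by linarith)).and
        ((hdiag k κ hκ).eventually_le_const (by linarith))
    · by_cases hjk : j = k
      · exact Eventually.of_forall fun t h => absurd hjk h
      · filter_upwards [(hoff j k κ hjk hκ).eventually_le_const
          (show 0 < κ * cm / (8 * m) by positivity)] with t ht _ using ht
  obtain ⟨A, hA⟩ := eventually_atTop.mp hev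
  set K : ℝ := 4 * (∑ j, |Cr j|) * T / (κ * cm)
  have hdecay : Tendsto (fun u : ℝ => K * Real.exp ((1 - β) / 2) *
      ((u + 1) ^ 3 * Real.exp (-((1 - β) / 2) * u))) atTop (𝓝 0) := by
    have hb : (0 : ℝ) < (1 - β) / 2 := by linarith
    have h1 := (Real.tendsto_pow_mul_exp_neg_atTop_nhds_zero 3).comp
      (tendsto_id.const_mul_atTop hb)
    have h2 : Tendsto (fun u : ℝ => ((u + 1) / ((1 - β) / 2 * u)) ^ 3) atTop
        (𝓝 ((1 / ((1 - β) / 2)) ^ 3)) := by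
      refine Tendsto.pow ?_ 3
      have h3 : Tendsto (fun u : ℝ => (1 + 1 / u) / ((1 - β) / 2)) atTop
          (𝓝 ((1 + 0) / ((1 - β) / 2))) :=
        ((tendsto_const_nhds.div_atTop tendsto_id).const_add 1).div_const _
      rw [add_zero] at h3
      refine h3.congr' ?_
      filter_upwards [eventually_gt_atTop 0] with u hu
      field_simp
    have h4 := (h2.mul h1).const_mul (K * Real.exp ((1 - β) / 2))
    rw [mul_zero, mul_zero] at h4
    refine h4.congr' ?_
    filter_upwards [eventually_gt_atTop 0] with u hu
    have hne : (1 - β) / 2 * u ≠ 0 := by positivity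
    simp only [Function.comp, id]
    congr 1
    rw [← mul_assoc, ← mul_pow, div_mul_cancel₀ _ hne, neg_mul]
  have hsmall : ∀ᶠ u : ℝ in atTop, ∀ j, C j * Real.exp (-(2 - β) * u) ≤ κ := by
    refine eventually_all.mpr fun j => ?_
    have h1 := (Real.tendsto_exp_neg_atTop_nhds_zero.comp
      (tendsto_id.const_mul_atTop (show (0 : ℝ) < 2 - β by linarith))).const_mul (C j)
    rw [mul_zero] at h1
    filter_upwards [h1.eventually_le_const hκ] with u hu
    simpa only [Function.comp, id, neg_mul] using hu
  filter_upwards [hsmall, hdecay.eventually_lt_const one_pos, eventually_ge_atTop A,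
    eventually_ge_atTop 1, eventually_ge_atTop (Real.log (N + 1))] with u hu1 hu2 hu3 hu4 hu5
  by_contra! hcon
  obtain ⟨j₁, x₁, hx₁, hlt⟩ := hcon
  -- `x₀` is where the largest of the functions attains its maximum `M` on `[u, u + 1]`
  have hcont : Continuous fun x : ℝ => ‖fun j => φ j (expFun s (x : ℂ))‖ :=
    (continuous_pi fun j => (φ j).continuous.comp (continuous_expFun s)).norm
  obtain ⟨x₀, hx₀, hmax⟩ := (isCompact_Icc (a := u) (b := u + 1)).exists_isMaxOn
    ⟨u, by constructor <;> linarith⟩ hcont.continuousOn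
  set M := ‖fun j => φ j (expFun s (x₀ : ℂ))‖ with hMdef
  have hMle : ∀ j, ∀ x ∈ Set.Icc u (u + 1), ‖φ j (expFun s (x : ℂ))‖ ≤ M := fun j x hx =>
    (norm_le_pi_norm (fun j => φ j (expFun s (x : ℂ))) j).trans (hmax hx)
  have hMgt : Real.exp (-β * u) < M := hlt.trans_le (hMle j₁ x₁ hx₁)
  have hM0 : 0 < M := (Real.exp_pos _).trans hMgt
  obtain ⟨j₀, hj₀⟩ : ∃ j₀, ‖φ j₀ (expFun s (x₀ : ℂ))‖ = M := by
    obtain ⟨j₀, h⟩ := Finite.exists_max fun j => ‖φ j (expFun s (x₀ : ℂ))‖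
    exact ⟨j₀, le_antisymm (hMle j₀ x₀ hx₀)
      ((pi_norm_le_iff_of_nonneg (norm_nonneg _)).mpr h)⟩
  have hu0 : 0 < u := by linarith
  have hκu : κ / u ^ 2 ≤ 1 / 2 := by
    rw [div_le_iff₀ (by positivity)]
    nlinarith
  have hκu0 : 0 < κ / u ^ 2 := by positivity
  -- a short interval on one side of `x₀`, inside `[u, u + 1]`
  obtain ⟨t, ht1, ht2, ht3, ht4⟩ : ∃ t, u ≤ t ∧ t + κ / t ^ 2 ≤ u + 1 ∧ x₀ - κ / u ^ 2 ≤ t ∧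
      t + κ / t ^ 2 ≤ x₀ + κ / u ^ 2 := by
    have hmono : ∀ t, u ≤ t → κ / t ^ 2 ≤ κ / u ^ 2 := fun t ht => by gcongr
    by_cases hx : x₀ ≤ u + 1 / 2
    · exact ⟨x₀, hx₀.1, by linarith [hmono x₀ hx₀.1], by linarith, by linarith [hmono x₀ hx₀.1]⟩
    · push Not at hx
      have hh : u ≤ x₀ - κ / u ^ 2 := by linarith
      exact ⟨_, hh, by linarith [hmono _ hh, hx₀.2], le_rfl, by linarith [hmono _ hh, hx₀.2]⟩
  have ht0 : 0 < t := by linarith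
  set w := t ^ 3 * Real.exp (-t) with hw
  have hwpos : 0 < w := by positivity
  obtain ⟨hB1, hB2⟩ := hA t (hu3.trans ht1)
  -- the primes in the short interval
  have hI : ∀ p ∈ shortPrimes κ t, p.Prime ∧ Real.exp t < p ∧ (p : ℝ) ≤ Real.exp (t + κ / t ^ 2) := by
    intro p hp
    simp only [shortPrimes, Finset.mem_filter, Finset.mem_Ioc] at hp
    exact ⟨hp.2, (Nat.floor_lt (Real.exp_pos _).le).mp hp.1.1,
      (Nat.le_floor_iff (Real.exp_pos _).le).mp hp.1.2⟩
  have hlog : ∀ p ∈ shortPrimes κ t, t ≤ Real.log p ∧ Real.log p ≤ t + κ / t ^ 2 := by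
    intro p hp
    obtain ⟨hpp, h1, h2⟩ := hI p hp
    have hp0 : (0 : ℝ) < p := by exact_mod_cast hpp.pos
    exact ⟨((Real.lt_log_iff_exp_lt hp0).mpr h1).le, (Real.log_le_iff_le_exp hp0).mpr h2⟩
  have hfreeze : ∀ j, ∀ p ∈ shortPrimes κ t,
      ‖φ j (expFun s (Real.log p : ℝ)) - φ j (expFun s (x₀ : ℂ))‖ ≤ 33 * κ * M := by
    intro j p hp
    obtain ⟨h1, h2⟩ := hlog p hp
    have hle := hvar j u M hu4 hM0.le (hMle j) (Real.log p) ⟨by linarith, by linarith⟩ x₀ hx₀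
    have hd : |Real.log p - x₀| ≤ κ / u ^ 2 := by rw [abs_le]; constructor <;> linarith
    have hCs : C j * Real.exp (-2 * u) ≤ κ * M := by
      calc C j * Real.exp (-2 * u) = C j * Real.exp (-(2 - β) * u) * Real.exp (-β * u) := by
            rw [mul_assoc, ← Real.exp_add]; congr 2; ring
        _ ≤ κ * M := mul_le_mul (hu1 j) hMgt.le (Real.exp_pos _).le hκ.le
    have hκM : κ * M ≤ M := by nlinarith
    calc _ ≤ 16 * u ^ 2 * (M + C j * Real.exp (-2 * u)) * |Real.log p - x₀| +
            C j * Real.exp (-2 * u) := hle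
      _ ≤ 16 * u ^ 2 * (M + M) * (κ / u ^ 2) + κ * M := by
          have hnn : 0 ≤ M + C j * Real.exp (-2 * u) := by
            have := hC j; positivity
          gcongr
          exact hCs.trans hκM
      _ = 33 * κ * M := by field_simp; ring
  have hcore := mul_le_norm_correlation (a := a) (ρ := fun j p => φ j (expFun s (Real.log p : ℝ)))
    (v := fun j => φ j (expFun s (x₀ : ℂ))) (I := shortPrimes κ t) (j₀ := j₀)
    (δ := 33 * κ * M) (U := 2 * (cM * κ) / w) (Lo := cm * κ / 2 / w) (ε := κ * cm / (8 * m) / w)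
    (fun j => hMle j x₀ hx₀) hj₀ (by positivity) (by positivity) hfreeze
    (fun j => by
      rw [le_div_iff₀ hwpos]
      refine (hB1 j).2.trans ?_
      gcongr
      exact hk₂ j)
    (by
      rw [div_le_iff₀ hwpos]
      refine le_trans ?_ (hB1 j₀).1
      gcongr
      exact hk₁ j₀)
    (fun j hj => by
      rw [le_div_iff₀ hwpos]
      exact hB2 j j₀ hj)
  have hupper : ‖∑ p ∈ shortPrimes κ t, (starRingEnd ℂ) (a j₀ p) *
      ∑ j, a j p * φ j (expFun s (Real.log p : ℝ))‖ ≤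
      (∑ j, |Cr j|) * Real.exp ((1 - β) / 2 * (u + 1)) * T := by
    calc _ ≤ ∑ p ∈ shortPrimes κ t, (∑ j, |Cr j|) * Real.exp ((1 - β) / 2 * (u + 1)) *
          ‖∑ j, a j p * φ j (expFun s (Real.log p : ℝ))‖ := by
          refine (norm_sum_le _ _).trans (Finset.sum_le_sum fun p hp => ?_)
          rw [norm_mul, RCLike.norm_conj]
          gcongr
          obtain ⟨hpp, -, h2⟩ := hI p hp
          have hp0 : (0 : ℝ) < p := by exact_mod_cast hpp.pos
          refine (hCr j₀ p hpp.one_le).trans ?_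
          gcongr
          · exact (le_abs_self _).trans
              (Finset.single_le_sum (f := fun j => |Cr j|) (fun _ _ => abs_nonneg _)
                (Finset.mem_univ j₀))
          · rw [Real.rpow_def_of_pos hp0, mul_comm]
            gcongr
            linarith [(hlog p hp).2]
      _ ≤ _ := by
          rw [← Finset.mul_sum]
          gcongr
          refine hT _ fun p hp => ⟨(hI p hp).1, ?_⟩
          have h1 : (N : ℝ) + 1 ≤ Real.exp t :=
            (Real.log_le_iff_le_exp (by positivity)).mp (hu5.trans ht1)
          have h2 := (hI p hp).2.1
          have : (N : ℝ) < p := by linarith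
          exact_mod_cast this
  -- compare the two bounds
  have h1 : M * (κ * cm / 4) ≤ (∑ j, |Cr j|) * Real.exp ((1 - β) / 2 * (u + 1)) * T * w := by
    have h2 := hcore.trans (add_le_add_left (add_le_add_left hupper _) _)
    have h3 := mul_le_mul_of_nonneg_right h2 hwpos.le
    have e1 : M * (cm * κ / 2 / w) * w = M * (cm * κ / 2) := by field_simp
    have e2 : ((∑ j, |Cr j|) * Real.exp ((1 - β) / 2 * (u + 1)) * T +
        M * (m * (κ * cm / (8 * m) / w)) + 33 * κ * M * (m * (2 * (cM * κ) / w))) * w =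
        (∑ j, |Cr j|) * Real.exp ((1 - β) / 2 * (u + 1)) * T * w + M * (κ * cm / 8) +
        M * κ * (66 * m * cM * κ) := by
      field_simp
      ring
    rw [e1, e2] at h3
    have h4 : M * κ * (66 * m * cM * κ) ≤ M * κ * (cm / 8) := by gcongr
    linarith
  have hw2 : w ≤ (u + 1) ^ 3 * Real.exp (-u) := by
    have htu : t ≤ u + 1 := by
      have : 0 < κ / t ^ 2 := by positivity
      linarith
    rw [hw]
    gcongr
  have h5 : M ≤ K * Real.exp ((1 - β) / 2) *
      ((u + 1) ^ 3 * Real.exp (-((1 - β) / 2) * u)) * Real.exp (-β * u) := by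
    have hx : Real.exp ((1 - β) / 2 * (u + 1)) * Real.exp (-u) =
        Real.exp ((1 - β) / 2) * Real.exp (-((1 - β) / 2) * u) * Real.exp (-β * u) := by
      rw [← Real.exp_add, ← Real.exp_add, ← Real.exp_add]
      congr 1
      ring
    have h6 : M * (κ * cm / 4) ≤ (∑ j, |Cr j|) * T * (u + 1) ^ 3 *
        (Real.exp ((1 - β) / 2 * (u + 1)) * Real.exp (-u)) := by
      refine h1.trans ?_
      calc _ ≤ (∑ j, |Cr j|) * Real.exp ((1 - β) / 2 * (u + 1)) * T *
            ((u + 1) ^ 3 * Real.exp (-u)) := by gcongr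
        _ = _ := by ring
    rw [hx] at h6
    rw [← le_div_iff₀ (by positivity)] at h6
    refine h6.trans (le_of_eq ?_)
    simp only [K]
    field_simp
  have h7 : K * Real.exp ((1 - β) / 2) *
      ((u + 1) ^ 3 * Real.exp (-((1 - β) / 2) * u)) * Real.exp (-β * u) ≤ 1 * Real.exp (-β * u) := by
    gcongr
  linarith

theorem exists_norm_le_mul_exp_neg {s : C(X, ℂ)} (hs : ∀ x, 0 ≤ (s x).re)
    {φ : C(X, ℂ) →L[ℂ] ℂ} {β : ℝ} (hβ : 0 ≤ β)
    (h : ∀ᶠ u : ℝ in atTop, ‖φ (expFun s (u : ℂ))‖ ≤ Real.exp (-β * u)) :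
    ∃ C : ℝ, 0 ≤ C ∧ ∀ x : ℝ, 0 ≤ x → ‖φ (expFun s (x : ℂ))‖ ≤ C * Real.exp (-β * x) := by
  obtain ⟨A, hA⟩ := eventually_atTop.mp h
  refine ⟨1 + ‖φ‖ * Real.exp (β * |A|), by positivity, fun x hx => ?_⟩
  rw [add_mul, one_mul]
  rcases le_total A x with hAx | hAx
  · have : 0 ≤ ‖φ‖ * Real.exp (β * |A|) * Real.exp (-β * x) := by positivity
    linarith [hA x hAx]
  · have h1 : ‖φ (expFun s (x : ℂ))‖ ≤ ‖φ‖ * 1 :=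
      φ.le_opNorm_of_le (by simpa using norm_expFun_le hs hx)
    have h2 : 1 ≤ Real.exp (β * |A|) * Real.exp (-β * x) := by
      rw [← Real.exp_add]
      apply Real.one_le_exp
      have := mul_le_mul_of_nonneg_left (hAx.trans (le_abs_self A)) hβ
      linarith
    have h3 := mul_le_mul_of_nonneg_left h2 (norm_nonneg φ)
    rw [← mul_assoc] at h3
    linarith [Real.exp_pos (-β * x)]

end Decay

/-! ### The Cauchy transform of a functional on `C(X, ℂ)` -/

section CauchyTransform

open MeasureTheory in
/-- The Laplace transform of a continuous function which is `O(e^{-βx})` is holomorphic for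
`Re w < β`. -/
theorem differentiableAt_laplace {ρ : ℝ → ℂ} {C β : ℝ} (hρ : Continuous ρ)
    (hb : ∀ x : ℝ, 0 ≤ x → ‖ρ x‖ ≤ C * Real.exp (-β * x)) {w : ℂ} (hw : w.re < β) :
    DifferentiableAt ℂ (fun w : ℂ => ∫ x in Set.Ioi (0 : ℝ), ρ x * Complex.exp (w * x)) w := by
  set d := (β - w.re) / 3 with hd
  have hd0 : 0 < d := by simp only [hd]; linarith
  have hC : 0 ≤ C := by simpa using (norm_nonneg _).trans (hb 0 le_rfl)
  have hbound : ∀ v ∈ Metric.ball w d, ∀ x : ℝ, 0 ≤ x →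
      ‖ρ x * Complex.exp (v * x)‖ ≤ C * Real.exp (-(2 * d) * x) := by
    intro v hv x hx
    have hre : v.re ≤ w.re + d := by
      have h1 := (Complex.abs_re_le_norm (v - w)).trans (mem_ball_iff_norm.mp hv).le
      rw [Complex.sub_re] at h1
      linarith [le_abs_self (v.re - w.re)]
    rw [norm_mul, Complex.norm_exp]
    calc ‖ρ x‖ * Real.exp (v * x).re ≤ C * Real.exp (-β * x) * Real.exp ((w.re + d) * x) := by
          gcongr
          · exact hb x hx
          · simp
            gcongr
      _ = C * Real.exp (-(2 * d) * x) := by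
          rw [mul_assoc, ← Real.exp_add]
          congr 2
          rw [show w.re = β - 3 * d by simp only [hd]; ring]
          ring
  have hcont : ∀ v : ℂ, Continuous fun x : ℝ => ρ x * Complex.exp (v * x) := fun v => by fun_prop
  have hint : ∀ c : ℝ, 0 < c → IntegrableOn (fun x : ℝ => C * Real.exp (-c * x)) (Set.Ioi 0) :=
    fun c hc => (integrableOn_exp_mul_Ioi (by linarith) 0).const_mul C
  refine (hasDerivAt_integral_of_dominated_loc_of_deriv_le
    (F := fun (w : ℂ) (x : ℝ) => ρ x * Complex.exp (w * x))
    (F' := fun (w : ℂ) (x : ℝ) => x * (ρ x * Complex.exp (w * x)))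
    (bound := fun x => 1 / d * (C * Real.exp (-d * x)))
    (Metric.ball_mem_nhds w hd0) (Eventually.of_forall fun v => (hcont v).aestronglyMeasurable)
    ?_ ?_ ?_ ((hint d hd0).const_mul _) ?_).2.differentiableAt
  · refine (hint (2 * d) (by positivity)).mono' (hcont w).aestronglyMeasurable ?_
    filter_upwards [ae_restrict_mem measurableSet_Ioi] with x hx
    exact hbound w (Metric.mem_ball_self hd0) x (Set.mem_Ioi.mp hx).le
  · exact (Continuous.mul (by fun_prop) (hcont w)).aestronglyMeasurable
  · filter_upwards [ae_restrict_mem measurableSet_Ioi] with x hx v hv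
    have hx0 : 0 ≤ x := (Set.mem_Ioi.mp hx).le
    rw [norm_mul, Complex.norm_real, Real.norm_eq_abs, abs_of_nonneg hx0]
    have h1 : x ≤ 1 / d * Real.exp (d * x) := by
      rw [one_div, inv_mul_eq_div, le_div_iff₀ hd0]
      linarith [Real.add_one_le_exp (d * x)]
    calc _ ≤ 1 / d * Real.exp (d * x) * (C * Real.exp (-(2 * d) * x)) :=
          mul_le_mul h1 (hbound v hv x hx0) (norm_nonneg _) (by positivity)
      _ = 1 / d * (C * (Real.exp (d * x) * Real.exp (-(2 * d) * x))) := by ring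
      _ = _ := by rw [← Real.exp_add]; congr 3; ring
  · refine Eventually.of_forall fun x v _ => ?_
    have h1 : HasDerivAt (fun w : ℂ => w * (x : ℂ)) (x : ℂ) v := hasDerivAt_mul_const _
    exact ((h1.cexp).const_mul (ρ x)).congr_deriv (by ring)

theorem mem_resolventSet_of_forall_ne {X : Type*} [TopologicalSpace X] {s : C(X, ℂ)} {w : ℂ}
    (hw : ∀ x, s x ≠ w) : w ∈ resolventSet ℂ s := by
  have h : w ∉ spectrum ℂ s := by
    rw [ContinuousMap.spectrum_eq_range]
    rintro ⟨x, hx⟩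
    exact hw x hx
  simpa [spectrum] using h

theorem resolvent_apply_mul {X : Type*} [TopologicalSpace X] {s : C(X, ℂ)} {w : ℂ}
    (hw : w ∈ resolventSet ℂ s) (x : X) :
    (w - s x) * resolvent s w x = 1 := by
  have h := Ring.mul_inverse_cancel _ (spectrum.mem_resolventSet_iff.mp hw)
  have h2 := congrArg (fun f : C(X, ℂ) => f x) h
  simpa [resolvent] using h2

variable {X : Type*} [TopologicalSpace X] [CompactSpace X]

open MeasureTheory in
/-- The resolvent of `s` is the Laplace transform of `x ↦ e^{-xs}`. -/
theorem resolvent_eq_neg_laplace {s : C(X, ℂ)} {α : ℝ} (hα : ∀ x, α ≤ (s x).re)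
    (φ : C(X, ℂ) →L[ℂ] ℂ) {w : ℂ} (hw : w.re < α) :
    φ (resolvent s w) =
      -∫ x in Set.Ioi (0 : ℝ), φ (expFun s (x : ℂ)) * Complex.exp (w * x) := by
  have hcont : Continuous fun x : ℝ => Complex.exp (w * x) • expFun s (x : ℂ) :=
    (by fun_prop : Continuous fun x : ℝ => Complex.exp (w * x)).smul (continuous_expFun s)
  have hint : Integrable (fun x : ℝ => Complex.exp (w * x) • expFun s (x : ℂ))
      (volume.restrict (Set.Ioi 0)) := by
    refine (integrableOn_exp_mul_Ioi (show w.re - α < 0 by linarith) 0).mono'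
      hcont.aestronglyMeasurable ?_
    filter_upwards [ae_restrict_mem measurableSet_Ioi] with x hx
    have hx0 : 0 ≤ x := (Set.mem_Ioi.mp hx).le
    rw [norm_smul, Complex.norm_exp]
    calc _ ≤ Real.exp (w * x).re * Real.exp (-α * x) := by
          gcongr; exact norm_expFun_le hα hx0
      _ = Real.exp ((w.re - α) * x) := by
          rw [← Real.exp_add]; congr 1; simp; ring
  have hres : w ∈ resolventSet ℂ s := mem_resolventSet_of_forall_ne fun x hx => by
    have := hα x
    rw [hx] at this
    linarith
  have hval : resolvent s w = -∫ x in Set.Ioi (0 : ℝ), Complex.exp (w * x) • expFun s (x : ℂ) := by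
    ext y
    have h1 := (ContinuousMap.evalCLM ℂ y : C(X, ℂ) →L[ℂ] ℂ).integral_comp_comm hint
    simp only [ContinuousMap.evalCLM_apply] at h1
    rw [ContinuousMap.neg_apply, ← h1]
    have hy : (w - s y).re < 0 := by rw [Complex.sub_re]; linarith [hα y]
    have h2 : ∀ x : ℝ, (Complex.exp (w * x) • expFun s (x : ℂ)) y =
        Complex.exp ((w - s y) * x) := by
      intro x
      rw [ContinuousMap.smul_apply, expFun_apply, smul_eq_mul, ← Complex.exp_add]
      congr 1
      ring
    simp only [h2]
    rw [integral_exp_mul_complex_Ioi hy]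
    have hne : w - s y ≠ 0 := fun h => by rw [h] at hy; simp at hy
    rw [eq_comm, ← mul_right_inj' hne, resolvent_apply_mul hres]
    simp
    field_simp
  rw [hval, map_neg, ← φ.integral_comp_comm hint]
  congr 1
  refine integral_congr_ae (Eventually.of_forall fun x => ?_)
  simp [mul_comm]

/-- A functional killing the resolvent of `s` near infinity kills the exponentials `e^{-zs}`. -/
theorem map_expFun_eq_zero_of_resolvent {s : C(X, ℂ)} {φ : C(X, ℂ) →L[ℂ] ℂ}
    (h : ∀ᶠ w in Bornology.cobounded ℂ, φ (resolvent s w) = 0) (z : ℂ) :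
    φ (expFun s z) = 0 := by
  have hps := (spectrum.hasFPowerSeriesOnBall_inverse_one_sub_smul ℂ s)
  have hps2 := (φ.comp_hasFPowerSeriesOnBall hps).hasFPowerSeriesAt
  have hinv : ∀ᶠ z : ℂ in 𝓝[≠] 0, (φ ∘ fun z : ℂ => Ring.inverse (1 - z • s)) z = 0 := by
    have h1 := tendsto_inv₀_nhdsNE_zero.eventually (h.and (spectrum.eventually_isUnit_resolvent s))
    filter_upwards [h1, self_mem_nhdsWithin] with z hz hz0
    have hz0 : z ≠ 0 := hz0
    have hres := spectrum.isUnit_resolvent.mpr hz.2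
    have heq : Ring.inverse (1 - z • s) = z⁻¹ • resolvent s z⁻¹ := by
      have hu := spectrum.mem_resolventSet_iff.mp hres
      have h2 : (1 : C(X, ℂ)) - z • s = z • (algebraMap ℂ C(X, ℂ) z⁻¹ - s) := by
        rw [smul_sub, Algebra.algebraMap_eq_smul_one, smul_smul, mul_inv_cancel₀ hz0, one_smul]
      have h3 : (1 - z • s) * (z⁻¹ • resolvent s z⁻¹) = 1 := by
        rw [h2, smul_mul_smul_comm, mul_inv_cancel₀ hz0, one_smul]
        exact Ring.mul_inverse_cancel _ hu
      have hu2 : IsUnit ((1 : C(X, ℂ)) - z • s) := IsUnit.of_mul_eq_one _ h3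
      calc Ring.inverse (1 - z • s)
          = Ring.inverse (1 - z • s) * ((1 - z • s) * (z⁻¹ • resolvent s z⁻¹)) := by
            rw [h3, mul_one]
        _ = _ := by rw [← mul_assoc, Ring.inverse_mul_cancel _ hu2, one_mul]
    simp only [Function.comp]
    rw [heq, map_smul, hz.1, smul_zero]
  have hev := hps2.analyticAt.frequently_zero_iff_eventually_zero.mp hinv.frequently
  have hzero := hps2.eq_zero_of_eventually hev
  have hpow : ∀ n : ℕ, φ (s ^ n) = 0 := by
    intro n
    have h1 : φ (ContinuousMultilinearMap.mkPiRing ℂ (Fin n) (s ^ n) fun _ => 1) = 0 :=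
      congrArg (fun p : FormalMultilinearSeries ℂ ℂ ℂ => p n fun _ => 1) hzero
    simpa using h1
  have hexp : HasSum (fun n : ℕ => ((n.factorial : ℂ)⁻¹) • (-z • s) ^ n) (expFun s z) := by
    have h1 : NormedSpace.exp (-z • s) = expFun s z := by
      ext x
      change (ContinuousMap.evalAlgHom ℂ ℂ x : C(X, ℂ) →ₐ[ℂ] ℂ) (NormedSpace.exp (-z • s)) = _
      rw [NormedSpace.map_exp (ContinuousMap.evalAlgHom ℂ ℂ x : C(X, ℂ) →ₐ[ℂ] ℂ)
        (continuous_eval_const x) (-z • s), expFun_apply, Complex.exp_eq_exp_ℂ]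
      simp
    rw [← h1]
    exact NormedSpace.exp_series_hasSum_exp' (𝕂 := ℂ) (-z • s)
  have h2 := hexp.mapL φ
  refine h2.unique ?_
  convert hasSum_zero using 2 with n
  rw [map_smul, smul_pow, map_smul, hpow, smul_zero, smul_zero]

/-- If `φ(e^{-xs})` decays faster than `e^{-αx}`, where `α` bounds the real part of `s`, then it
vanishes identically: the Cauchy transform of `φ` extends to a bounded entire function. -/
theorem map_expFun_eq_zero {s : C(X, ℂ)} {α₁ α₂ β C : ℝ} (hα₁ : ∀ x, α₁ ≤ (s x).re)
    (hα₂ : ∀ x, (s x).re ≤ α₂) (hβ : α₂ < β) {φ : C(X, ℂ) →L[ℂ] ℂ}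
    (hφ : ∀ x : ℝ, 0 ≤ x → ‖φ (expFun s (x : ℂ))‖ ≤ C * Real.exp (-β * x)) (z : ℂ) :
    φ (expFun s z) = 0 := by
  rcases isEmpty_or_nonempty X with hX | ⟨⟨x₁⟩⟩
  · rw [Subsingleton.elim (expFun s z) 0, map_zero]
  have hα : α₁ ≤ α₂ := (hα₁ x₁).trans (hα₂ x₁)
  set H := ‖s‖ with hH
  have him : ∀ x, |(s x).im| ≤ H := fun x =>
    (Complex.abs_im_le_norm _).trans (s.norm_coe_le_norm x)
  set F : ℂ → ℂ := fun w => φ (resolvent s w) with hF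
  set G : ℂ → ℂ := fun w => -∫ x in Set.Ioi (0 : ℝ), φ (expFun s (x : ℂ)) * Complex.exp (w * x)
    with hG
  have hGd : ∀ w : ℂ, w.re < β → DifferentiableAt ℂ G w := fun w hw =>
    (differentiableAt_laplace (φ.continuous.comp (continuous_expFun s)) hφ hw).neg
  have hFd : ∀ w : ℂ, (w.re < α₁ ∨ α₂ < w.re ∨ w.im < -H ∨ H < w.im) → DifferentiableAt ℂ F w := by
    intro w hw
    have hres : w ∈ resolventSet ℂ s := mem_resolventSet_of_forall_ne fun x hx => by
      have h1 := hα₁ x; have h2 := hα₂ x; have h3 := abs_le.mp (him x)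
      rw [hx] at h1 h2 h3
      rcases hw with h | h | h | h <;> linarith [h3.1, h3.2]
    exact φ.differentiableAt.comp w (spectrum.hasDerivAt_resolvent_const_left hres).differentiableAt
  have hFG1 : ∀ w : ℂ, w.re < α₁ → F w = G w := fun w hw => resolvent_eq_neg_laplace hα₁ φ hw
  -- propagation of the identity `F = G` through convex pieces of the complement of a rectangle
  have hprop : ∀ U : Set ℂ, IsOpen U → Convex ℝ U →
      (∀ w ∈ U, w.re < β ∧ (w.re < α₁ ∨ α₂ < w.re ∨ w.im < -H ∨ H < w.im)) →
      (∃ w₀ ∈ U, ∀ᶠ w in 𝓝 w₀, F w = G w) → ∀ w ∈ U, F w = G w := by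
    intro U hU hUc hmem ⟨w₀, hw₀, hev⟩ w hw
    have hFa : AnalyticOnNhd ℂ F U := DifferentiableOn.analyticOnNhd
      (fun w hw => (hFd w (hmem w hw).2).differentiableWithinAt) hU
    have hGa : AnalyticOnNhd ℂ G U := DifferentiableOn.analyticOnNhd
      (fun w hw => (hGd w (hmem w hw).1).differentiableWithinAt) hU
    exact hFa.eqOn_of_preconnected_of_eventuallyEq hGa hUc.isPreconnected hw₀ hev hw
  have hFG2 : ∀ w : ℂ, w.re < β → (w.im < -H ∨ H < w.im) → F w = G w := by
    have hnear : ∀ t : ℝ, ∀ᶠ w in 𝓝 (⟨α₁ - 1, t⟩ : ℂ), F w = G w := fun t => by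
      filter_upwards [(isOpen_lt Complex.continuous_re continuous_const).mem_nhds
        (show (⟨α₁ - 1, t⟩ : ℂ).re < α₁ by simp)] with w hw using hFG1 w hw
    rintro w hw (h | h)
    · refine hprop ({w : ℂ | w.re < β} ∩ {w : ℂ | w.im < -H})
        ((isOpen_lt Complex.continuous_re continuous_const).inter
          (isOpen_lt Complex.continuous_im continuous_const))
        ((convex_halfSpace_re_lt β).inter (convex_halfSpace_im_lt (-H)))
        (fun w hw => ⟨hw.1, Or.inr (Or.inr (Or.inl hw.2))⟩)
        ⟨⟨α₁ - 1, -H - 1⟩, ⟨?_, ?_⟩, hnear _⟩ w ⟨hw, h⟩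
      · change α₁ - 1 < β; linarith
      · change -H - 1 < -H; linarith
    · refine hprop ({w : ℂ | w.re < β} ∩ {w : ℂ | H < w.im})
        ((isOpen_lt Complex.continuous_re continuous_const).inter
          (isOpen_lt continuous_const Complex.continuous_im))
        ((convex_halfSpace_re_lt β).inter (convex_halfSpace_im_gt H))
        (fun w hw => ⟨hw.1, Or.inr (Or.inr (Or.inr hw.2))⟩)
        ⟨⟨α₁ - 1, H + 1⟩, ⟨?_, ?_⟩, hnear _⟩ w ⟨hw, h⟩
      · change α₁ - 1 < β; linarith
      · change H < H + 1; linarith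
  have hFG3 : ∀ w : ℂ, α₂ < w.re → w.re < β → F w = G w := by
    intro w h1 h2
    refine hprop ({w : ℂ | α₂ < w.re} ∩ {w : ℂ | w.re < β})
        ((isOpen_lt continuous_const Complex.continuous_re).inter
          (isOpen_lt Complex.continuous_re continuous_const))
        ((convex_halfSpace_re_gt α₂).inter (convex_halfSpace_re_lt β))
        (fun w hw => ⟨hw.2, Or.inr (Or.inl hw.1)⟩)
        ⟨⟨(α₂ + β) / 2, H + 1⟩, ⟨?_, ?_⟩, ?_⟩ w ⟨h1, h2⟩
    · change α₂ < (α₂ + β) / 2; linarith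
    · change (α₂ + β) / 2 < β; linarith
    · filter_upwards [(isOpen_lt Complex.continuous_re continuous_const).mem_nhds
        (show (⟨(α₂ + β) / 2, H + 1⟩ : ℂ).re < β by change (α₂ + β) / 2 < β; linarith),
        (isOpen_lt continuous_const Complex.continuous_im).mem_nhds
        (show H < (⟨(α₂ + β) / 2, H + 1⟩ : ℂ).im by change H < H + 1; linarith)] with v hv1 hv2
      exact hFG2 v hv1 (Or.inr hv2)
  -- the glued entire function
  set E : ℂ → ℂ := fun w => if w.re < β then G w else F w with hE
  have hE2 : ∀ w : ℂ, α₂ < w.re → E w = F w := by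
    intro w hw
    simp only [hE]
    split_ifs with h
    · exact (hFG3 w hw h).symm
    · rfl
  have hEd : Differentiable ℂ E := by
    intro w
    rcases lt_or_ge w.re β with h | h
    · refine (hGd w h).congr_of_eventuallyEq ?_
      filter_upwards [(isOpen_lt Complex.continuous_re continuous_const).mem_nhds h] with v hv
      simp only [hE]
      exact if_pos hv
    · have h' : α₂ < w.re := by linarith
      refine (hFd w (Or.inr (Or.inl h'))).congr_of_eventuallyEq ?_
      filter_upwards [(isOpen_lt continuous_const Complex.continuous_re).mem_nhds h'] with v hv
      exact hE2 v hv
  have hEF : ∀ᶠ w in Bornology.cobounded ℂ, E w = F w := by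
    filter_upwards [eventually_cobounded_le_norm (|α₁| + |α₂| + H + 1)] with w hw
    rcases lt_or_ge α₂ w.re with h1 | h1
    · exact hE2 w h1
    · have hlt : w.re < β := by linarith
      simp only [hE, if_pos hlt]
      rcases lt_or_ge w.re α₁ with h2 | h2
      · exact (hFG1 w h2).symm
      · refine (hFG2 w hlt ?_).symm
        have h3 := Complex.norm_le_abs_re_add_abs_im w
        have h4 : |w.re| ≤ |α₁| + |α₂| := by
          rw [abs_le]
          constructor
          · linarith [neg_abs_le α₁, abs_nonneg α₂]
          · linarith [le_abs_self α₂, abs_nonneg α₁]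
        have h5 : H < |w.im| := by linarith
        rcases lt_abs.mp h5 with h | h
        · exact Or.inr h
        · exact Or.inl (by linarith)
  have hF0 : Tendsto F (Bornology.cobounded ℂ) (𝓝 0) := by
    have := (φ.continuous.tendsto 0).comp (spectrum.resolvent_tendsto_cobounded (𝕜 := ℂ) s)
    rwa [map_zero] at this
  have hE0 : Tendsto E (cocompact ℂ) (𝓝 0) := by
    rw [← Metric.cobounded_eq_cocompact]
    exact hF0.congr' (hEF.mono fun w hw => hw.symm)
  refine map_expFun_eq_zero_of_resolvent (hEF.mono fun w hw => ?_) z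
  change F w = 0
  rw [← hw]
  exact hEd.apply_eq_of_tendsto_cocompact w hE0

end CauchyTransform

/-! ### Density of combinations with coefficients of modulus at most one -/

section Combinations

variable {X : Type*} [TopologicalSpace X] [CompactSpace X]

/-- A functional which kills all exponentials `e^{-zs}` kills all functions holomorphic on an open
strip containing the values of `s`. The function `q = e^{iπ(s - σ₁)/(σ₂ - σ₁)}` maps the strip onto
the upper half-plane, each compact subset of which lies in a disc tangent to the real axis, so
that holomorphic functions are limits of polynomials in `q`. -/
theorem map_eq_zero_of_map_expFun_eq_zero {s : C(X, ℂ)} {σ₁ σ₂ : ℝ}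
    (hs : ∀ x, s x ∈ verticalStrip σ₁ σ₂) {φ : C(X, ℂ) →L[ℂ] ℂ}
    (hφ : ∀ z, φ (expFun s z) = 0) {f : ℂ → ℂ} (hf : DifferentiableOn ℂ f (verticalStrip σ₁ σ₂))
    {g : C(X, ℂ)} (hg : ∀ x, g x = f (s x)) : φ g = 0 := by
  rcases isEmpty_or_nonempty X with hX | hX
  · rw [Subsingleton.elim g 0, map_zero]
  have hσ : 0 < σ₂ - σ₁ := by
    obtain ⟨x⟩ := hX
    have := hs x
    linarith [this.1, this.2]
  set ℓ : ℂ := Complex.I * (Real.pi / (σ₂ - σ₁) : ℝ) with hℓ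
  have hℓ0 : ℓ ≠ 0 := mul_ne_zero Complex.I_ne_zero
    (by exact_mod_cast (div_pos Real.pi_pos hσ).ne')
  set q : C(X, ℂ) := Complex.exp (-ℓ * σ₁) • expFun s (-ℓ) with hq
  have hqx : ∀ x, q x = Complex.exp (ℓ * (s x - σ₁)) := by
    intro x
    rw [hq, ContinuousMap.smul_apply, expFun_apply, smul_eq_mul, ← Complex.exp_add]
    congr 1
    ring
  have him : ∀ x, (ℓ * (s x - σ₁)).im = Real.pi * (((s x).re - σ₁) / (σ₂ - σ₁)) := by
    intro x
    rw [hℓ, mul_assoc, Complex.I_mul_im, Complex.re_ofReal_mul, Complex.sub_re,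
      Complex.ofReal_re]
    ring
  have hratio : ∀ x, 0 < ((s x).re - σ₁) / (σ₂ - σ₁) ∧ ((s x).re - σ₁) / (σ₂ - σ₁) < 1 := by
    intro x
    refine ⟨div_pos (by linarith [(hs x).1]) hσ, (div_lt_one hσ).mpr (by linarith [(hs x).2])⟩
  have him0 : ∀ x, 0 < (ℓ * (s x - σ₁)).im ∧ (ℓ * (s x - σ₁)).im < Real.pi := by
    intro x
    rw [him]
    constructor
    · exact mul_pos Real.pi_pos (hratio x).1
    · have := mul_lt_mul_of_pos_left (hratio x).2 Real.pi_pos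
      linarith
  have hqim : ∀ x, 0 < (q x).im := by
    intro x
    rw [hqx, Complex.exp_im]
    exact mul_pos (Real.exp_pos _) (Real.sin_pos_of_pos_of_lt_pi (him0 x).1 (him0 x).2)
  -- a disc in the upper half-plane, tangent to the real axis, which contains the values of `q`
  obtain ⟨R, hR0, hR⟩ : ∃ R : ℝ, 0 < R ∧ ∀ x, ‖q x - Complex.I * R‖ < R := by
    obtain ⟨x₀, -, hx₀⟩ := (isCompact_univ (X := X)).exists_isMinOn Set.univ_nonempty
      (f := fun x => (q x).im) (Complex.continuous_im.comp q.continuous).continuousOn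
    set δ := (q x₀).im with hδ
    have hδ0 : 0 < δ := hqim x₀
    refine ⟨(‖q‖ ^ 2 + 1) / (2 * δ), by positivity, fun x => ?_⟩
    set R := (‖q‖ ^ 2 + 1) / (2 * δ) with hRdef
    have hR0 : 0 < R := by positivity
    have hRδ : 2 * R * δ = ‖q‖ ^ 2 + 1 := by rw [hRdef]; field_simp
    refine lt_of_pow_lt_pow_left₀ 2 hR0.le ?_
    have h1 : ‖q x - Complex.I * R‖ ^ 2 = ‖q x‖ ^ 2 - 2 * R * (q x).im + R ^ 2 := by
      rw [← Complex.normSq_eq_norm_sq, ← Complex.normSq_eq_norm_sq, Complex.normSq_apply,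
        Complex.normSq_apply]
      simp
      ring
    have h2 : ‖q x‖ ^ 2 ≤ ‖q‖ ^ 2 := by gcongr; exact q.norm_coe_le_norm x
    have h3 : 2 * R * δ ≤ 2 * R * (q x).im := by
      have : δ ≤ (q x).im := hx₀ (Set.mem_univ x)
      gcongr
    rw [h1]
    linarith
  set y : C(X, ℂ) := q - algebraMap ℂ C(X, ℂ) (Complex.I * R) with hy
  have hyx : ∀ x, y x = q x - Complex.I * R := fun x => by simp [hy]
  have hyR : ‖y‖ < R := (ContinuousMap.norm_lt_iff _ hR0).mpr fun x => by rw [hyx]; exact hR x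
  obtain ⟨r, hyr, hrR⟩ := exists_between hyR
  have hr0 : 0 < r := (norm_nonneg _).trans_lt hyr
  -- `f` in terms of the coordinate `q`
  set F : ℂ → ℂ := fun w => f (σ₁ + Complex.log w / ℓ) with hF
  have hFq : ∀ x, F (q x) = g x := by
    intro x
    simp only [hF]
    rw [hqx, Complex.log_exp (by linarith [(him0 x).1, Real.pi_pos]) (him0 x).2.le, hg]
    congr 1
    field_simp
    ring
  have hFd : DifferentiableOn ℂ F {w : ℂ | 0 < w.im} := by
    intro w hw
    have hw' : 0 < w.im := hw
    have hstrip : (σ₁ : ℂ) + Complex.log w / ℓ ∈ verticalStrip σ₁ σ₂ := by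
      have hre : ((σ₁ : ℂ) + Complex.log w / ℓ).re =
          σ₁ + (σ₂ - σ₁) * (Complex.arg w / Real.pi) := by
        have h1 : Complex.log w / ℓ = ((σ₂ - σ₁) / Real.pi : ℝ) * (-Complex.I * Complex.log w) := by
          have hpi : (Real.pi : ℂ) ≠ 0 := by exact_mod_cast Real.pi_ne_zero
          have hσc : (σ₂ : ℂ) - σ₁ ≠ 0 := by exact_mod_cast hσ.ne'
          have hI : Complex.I * Complex.I = -1 := Complex.I_mul_I
          rw [div_eq_iff hℓ0, hℓ]
          push_cast
          field_simp
          linear_combination (Complex.log w) * hI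
        rw [Complex.add_re, Complex.ofReal_re, h1, Complex.re_ofReal_mul]
        simp [Complex.log_im]
        ring
      have h1 : 0 < Complex.arg w := by
        refine lt_of_le_of_ne (Complex.arg_nonneg_iff.mpr hw'.le) fun h => ?_
        exact hw'.ne' (Complex.arg_eq_zero_iff.mp h.symm).2
      have h2 : Complex.arg w < Real.pi := by
        refine lt_of_le_of_ne (Complex.arg_le_pi w) fun h => ?_
        exact hw'.ne' (Complex.arg_eq_pi_iff.mp h).2
      have h3 : 0 < Complex.arg w / Real.pi := div_pos h1 Real.pi_pos
      have h4 : Complex.arg w / Real.pi < 1 := (div_lt_one Real.pi_pos).mpr h2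
      constructor <;> rw [hre] <;> nlinarith
    have hopen : IsOpen (verticalStrip σ₁ σ₂) :=
      (isOpen_lt continuous_const Complex.continuous_re).inter
        (isOpen_lt Complex.continuous_re continuous_const)
    have hlog : DifferentiableAt ℂ Complex.log w :=
      Complex.differentiableAt_log (Complex.mem_slitPlane_iff.mpr (Or.inr hw'.ne'))
    exact ((hf.differentiableAt (hopen.mem_nhds hstrip)).comp w
      ((hlog.div_const ℓ).const_add _)).differentiableWithinAt
  have hball : Metric.closedBall (Complex.I * R) r ⊆ {w : ℂ | 0 < w.im} := by
    intro w hw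
    have h1 := (Complex.abs_im_le_norm (w - Complex.I * R)).trans (mem_closedBall_iff_norm.mp hw)
    simp only [Complex.sub_im, Complex.I_mul_im, Complex.ofReal_re] at h1
    have := abs_le.mp h1
    change 0 < w.im
    linarith [this.1]
  have hrr : (r.toNNReal : ℝ) = r := Real.coe_toNNReal r hr0.le
  have hlt : ∀ t : NNReal, (t : ℝ) < r → t < r.toNNReal := fun t ht =>
    NNReal.coe_lt_coe.mp (by rwa [hrr])
  obtain ⟨p, hps⟩ : ∃ p, HasFPowerSeriesOnBall F p (Complex.I * R) r.toNNReal :=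
    ⟨_, (hFd.mono (by rwa [hrr])).hasFPowerSeriesOnBall (Real.toNNReal_pos.mpr hr0)⟩
  have hsum : Summable fun n : ℕ => p.coeff n • y ^ n := by
    have h1 : Summable fun n : ℕ => ‖p n‖ * ‖y‖ ^ n := by
      have := p.summable_norm_mul_pow (r := ‖y‖₊) (lt_of_lt_of_le ?_ hps.r_le)
      · simpa using this
      · exact ENNReal.coe_lt_coe.mpr (hlt _ hyr)
    refine Summable.of_norm_bounded h1 fun n => ?_
    rw [norm_smul, p.norm_apply_eq_norm_coef]
    gcongr
    exact norm_pow_le y n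
  have hsumg : HasSum (fun n : ℕ => p.coeff n • y ^ n) g := by
    have h1 := hsum.hasSum
    convert h1 using 1
    ext x
    have h2 := (ContinuousMap.evalCLM ℂ x : C(X, ℂ) →L[ℂ] ℂ).hasSum h1
    have h3 := hps.hasSum (y := y x) (by
      rw [Metric.mem_eball, edist_zero_right]
      exact ENNReal.coe_lt_coe.mpr (hlt _ (lt_of_le_of_lt (y.norm_coe_le_norm x) hyr)))
    rw [show Complex.I * R + y x = q x by rw [hyx]; ring, hFq] at h3
    rw [show (fun n => p n fun _ => y x) = fun n =>
      (ContinuousMap.evalCLM ℂ x : C(X, ℂ) →L[ℂ] ℂ) (p.coeff n • y ^ n) from funext fun n => by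
        rw [p.apply_eq_pow_smul_coeff, smul_eq_mul, mul_comm]
        rfl] at h3
    exact h3.unique h2
  have hqn : ∀ n : ℕ, φ (q ^ n) = 0 := by
    intro n
    have : q ^ n = Complex.exp (-ℓ * σ₁) ^ n • expFun s (-(n * ℓ)) := by
      ext x
      simp only [hq, smul_pow, ContinuousMap.smul_apply, ContinuousMap.pow_apply, expFun_apply,
        ← Complex.exp_nat_mul]
      congr 2
      ring
    rw [this, map_smul, hφ, smul_zero]
  have hyn : ∀ n : ℕ, φ (y ^ n) = 0 := by
    intro n
    rw [hy, sub_eq_add_neg, ← map_neg, add_pow, map_sum]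
    refine Finset.sum_eq_zero fun k _ => ?_
    have : q ^ k * algebraMap ℂ C(X, ℂ) (-(Complex.I * R)) ^ (n - k) * ((n.choose k : ℕ) : C(X, ℂ)) =
        ((-(Complex.I * R)) ^ (n - k) * (n.choose k : ℂ)) • q ^ k := by
      rw [Algebra.smul_def, map_mul, map_pow, map_natCast]
      ring
    rw [this, map_smul, hqn, smul_zero]
  refine (hsumg.mapL φ).unique ?_
  convert hasSum_zero using 2 with n
  rw [map_smul, hyn, smul_zero]

/-- The vector `(a_j(p) p^{-s})_j`, the first-order part of the local factor at `p`. -/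
noncomputable def localVector {m : ℕ} (a : Fin m → ℕ → ℂ) (s : C(X, ℂ)) (p : ℕ) : Fin m → C(X, ℂ) :=
  fun j => a j p • expFun s (Real.log p : ℝ)

/-- Finite combinations `∑_{p > N} z_p a_j(p) p^{-s}` with `|z_p| ≤ 1` are dense among the tuples
of holomorphic functions: a functional bounded on the set of these combinations would be
absolutely summable over the vectors `(a_j(p) p^{-s})_j`. -/
theorem exists_combination_near {m : ℕ} {a : Fin m → ℕ → ℂ} {c : Fin m → ℝ}
    (hram : ∀ ε : ℝ, 0 < ε → ∀ j, ∃ C : ℝ, ∀ n : ℕ, 1 ≤ n → ‖a j n‖ ≤ C * (n : ℝ) ^ ε)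
    (hc : ∀ k, 0 < c k)
    (hdiag : ∀ k κ, 0 < κ → Tendsto (fun t : ℝ =>
      (∑ p ∈ shortPrimes κ t, ‖a k p‖ ^ 2) * (t ^ 3 * Real.exp (-t))) atTop (𝓝 (c k * κ)))
    (hoff : ∀ j k κ, j ≠ k → 0 < κ → Tendsto (fun t : ℝ =>
      ‖∑ p ∈ shortPrimes κ t, a j p * (starRingEnd ℂ) (a k p)‖ * (t ^ 3 * Real.exp (-t)))
      atTop (𝓝 0))
    {σ₁ σ₂ : ℝ} (hσ₁ : 0 ≤ σ₁) (hσ₂ : σ₂ < 1)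
    {s : C(X, ℂ)} (hs : ∀ x, s x ∈ verticalStrip σ₁ σ₂)
    {f : Fin m → ℂ → ℂ} (hf : ∀ j, DifferentiableOn ℂ (f j) (verticalStrip σ₁ σ₂))
    (N : ℕ) {ε : ℝ} (hε : 0 < ε) :
    ∃ z : ℕ →₀ ℂ, (∀ n, ‖z n‖ ≤ 1) ∧ (∀ n, z n ≠ 0 → n.Prime ∧ N < n) ∧
      ∀ j x, ‖f j (s x) - ∑ n ∈ z.support, z n * (a j n * Complex.exp (-(Real.log n : ℝ) * s x))‖
        < ε := by
  set g : Fin m → C(X, ℂ) := fun j => ⟨fun x => f j (s x),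
    ((hf j).continuousOn.comp_continuous s.continuous hs)⟩ with hg
  set Z : Set (ℕ →₀ ℂ) := {z | (∀ n, ‖z n‖ ≤ 1) ∧ ∀ n, z n ≠ 0 → n.Prime ∧ N < n} with hZ
  set Φ := (Finsupp.linearCombination ℂ (localVector a s)).restrictScalars ℝ with hΦ
  have hconv : Convex ℝ Z := by
    intro z hz w hw α β hα hβ hαβ
    refine ⟨fun n => ?_, fun n hn => ?_⟩
    · rw [Finsupp.add_apply, Finsupp.smul_apply, Finsupp.smul_apply]
      calc _ ≤ ‖α • z n‖ + ‖β • w n‖ := norm_add_le _ _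
        _ ≤ α * 1 + β * 1 := by
          rw [norm_smul, norm_smul, Real.norm_of_nonneg hα, Real.norm_of_nonneg hβ]
          gcongr
          · exact hz.1 n
          · exact hw.1 n
        _ = 1 := by linarith
    · by_cases hzn : z n = 0
      · refine hw.2 n fun hwn => hn ?_
        simp [hzn, hwn]
      · exact hz.2 n hzn
  have hmem : g ∈ closure (Φ '' Z) := by
    by_contra hcon
    obtain ⟨φ, u, hφ1, hφ2⟩ := RCLike.geometric_hahn_banach_closed_point (𝕜 := ℂ)
      (hconv.linear_image Φ).closure isClosed_closure hcon
    set ψ : Fin m → C(X, ℂ) →L[ℂ] ℂ := fun j =>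
      φ.comp (ContinuousLinearMap.single ℂ (fun _ : Fin m => C(X, ℂ)) j) with hψ
    have hφψ : ∀ v : Fin m → C(X, ℂ), φ v = ∑ j, ψ j (v j) := by
      intro v
      conv_lhs => rw [← Finset.univ_sum_single v]
      rw [map_sum]
      rfl
    have hbd : ∀ F : Finset ℕ, (∀ p ∈ F, p.Prime ∧ N < p) →
        ∑ p ∈ F, ‖∑ j, a j p * ψ j (expFun s (Real.log p : ℝ))‖ ≤ u := by
      intro F hF
      have hval : ∀ p, φ (localVector a s p) = ∑ j, a j p * ψ j (expFun s (Real.log p : ℝ)) := by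
        intro p
        rw [hφψ]
        refine Finset.sum_congr rfl fun j _ => ?_
        rw [localVector, map_smul, smul_eq_mul]
      choose e he1 he2 using fun p => RCLike.exists_norm_eq_mul_self (φ (localVector a s p))
      set z : ℕ →₀ ℂ := Finsupp.onFinset F (fun p => if p ∈ F then e p else 0) (by
        intro p hp
        by_contra h
        exact hp (if_neg h)) with hz
      have hzZ : z ∈ Z := by
        refine ⟨fun n => ?_, fun n hn => ?_⟩
        · simp only [hz, Finsupp.onFinset_apply]
          split_ifs
          · exact (he1 n).le
          · simp
        · simp only [hz, Finsupp.onFinset_apply] at hn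
          by_cases h : n ∈ F
          · exact hF n h
          · exact absurd (if_neg h) hn
      have hΦz : Φ z = ∑ p ∈ F, e p • localVector a s p := by
        rw [hΦ, LinearMap.restrictScalars_apply, Finsupp.linearCombination_apply,
          Finsupp.onFinset_sum]
        · exact Finset.sum_congr rfl fun p hp => by rw [if_pos hp]
        · simp
      have h1 := (hφ1 _ (subset_closure ⟨z, hzZ, rfl⟩)).le
      rw [hΦz, map_sum] at h1
      refine le_trans (le_of_eq ?_) h1
      rw [map_sum]
      refine Finset.sum_congr rfl fun p _ => ?_
      rw [← hval, map_smul, smul_eq_mul, ← he2, RCLike.ofReal_re]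
    have hs0 : ∀ x, 0 ≤ (s x).re := fun x => hσ₁.trans (hs x).1.le
    have hkill : ∀ j, ψ j (g j) = 0 := by
      intro j
      refine map_eq_zero_of_map_expFun_eq_zero hs (fun z => ?_) (hf j) (fun x => rfl)
      have hβ1 : max σ₂ 0 < 1 := max_lt hσ₂ one_pos
      obtain ⟨β, hβ2, hβ3⟩ := exists_between hβ1
      have hev := eventually_norm_le_exp_neg hram hc hdiag hoff hs0 hbd hβ3
      obtain ⟨C, -, hC⟩ := exists_norm_le_mul_exp_neg hs0 (φ := ψ j)
        ((le_max_right _ _).trans hβ2.le)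
        (hev.mono fun u hu => hu j u ⟨le_rfl, by linarith⟩)
      exact map_expFun_eq_zero (fun x => (hs x).1.le) (fun x => (hs x).2.le)
        ((le_max_left _ _).trans_lt hβ2) hC z
    have hφg : φ g = 0 := by
      rw [hφψ]
      exact Finset.sum_eq_zero fun j _ => hkill j
    have h0 : (0 : Fin m → C(X, ℂ)) ∈ Φ '' Z := ⟨0, ⟨by simp, by simp⟩, map_zero _⟩
    have h1 := hφ1 0 (subset_closure h0)
    rw [hφg] at hφ2
    rw [map_zero] at h1
    linarith
  obtain ⟨_, ⟨z, hz, rfl⟩, hdist⟩ := Metric.mem_closure_iff.mp hmem ε hε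
  refine ⟨z, hz.1, hz.2, fun j x => ?_⟩
  rw [dist_eq_norm] at hdist
  have h1 : ‖(g - Φ z) j x‖ < ε :=
    ((((g - Φ z) j).norm_coe_le_norm x).trans (norm_le_pi_norm _ j)).trans_lt hdist
  have h2 : (g - Φ z) j x =
      f j (s x) - ∑ n ∈ z.support, z n * (a j n * Complex.exp (-(Real.log n : ℝ) * s x)) := by
    rw [Pi.sub_apply, ContinuousMap.sub_apply, hΦ, LinearMap.restrictScalars_apply,
      Finsupp.linearCombination_apply, Finsupp.sum, Finset.sum_apply, ContinuousMap.sum_apply]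
    rfl
  rwa [h2] at h1

end Combinations

/-! ### Rounding to coefficients of modulus one -/

section Greedy

variable {E : Type*} [NormedAddCommGroup E] [InnerProductSpace ℂ E]

theorem exists_circle_re_inner_nonpos (S v : E) {z : ℂ} (hz : ‖z‖ ≤ 1) :
    ∃ ω : Circle, (inner ℂ S ((z - (ω : ℂ)) • v)).re ≤ 0 := by
  obtain ⟨c, hc1, hc2⟩ := RCLike.exists_norm_eq_mul_self (inner ℂ S v)
  refine ⟨⟨c, mem_sphere_zero_iff_norm.mpr hc1⟩, ?_⟩
  change (inner ℂ S ((z - c) • v)).re ≤ 0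
  rw [inner_smul_right, sub_mul, ← hc2, Complex.sub_re]
  have h1 : (z * inner ℂ S v).re ≤ ‖inner ℂ S v‖ := by
    refine (Complex.re_le_norm _).trans ?_
    rw [norm_mul]
    exact mul_le_of_le_one_left (norm_nonneg _) hz
  have h2 : (((‖inner ℂ S v‖ : ℝ) : ℂ)).re = ‖inner ℂ S v‖ := Complex.ofReal_re _
  have h3 : ((RCLike.ofReal ‖inner ℂ S v‖ : ℂ)).re = ‖inner ℂ S v‖ := h2
  rw [h3]
  linarith

/-- Coefficients of modulus at most one can be rounded to modulus one so that the partial sums of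
the rounding errors stay bounded by the square sum of the vectors: each new error is chosen to
make an obtuse angle with the sum of the previous ones. -/
theorem exists_circle_rounding (v : ℕ → E) {z : ℕ → ℂ} (hz : ∀ n, ‖z n‖ ≤ 1) :
    ∃ ω : ℕ → Circle, ∀ k : ℕ, ‖∑ n ∈ Finset.range k, (z n - (ω n : ℂ)) • v n‖ ^ 2 ≤
      4 * ∑ n ∈ Finset.range k, ‖v n‖ ^ 2 := by
  choose w hw using fun (n : ℕ) (S : E) => exists_circle_re_inner_nonpos S (v n) (hz n)
  let S : ℕ → E := fun k => Nat.rec 0 (fun n T => T + (z n - (w n T : ℂ)) • v n) k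
  have hS : ∀ k, S k = ∑ n ∈ Finset.range k, (z n - (w n (S n) : ℂ)) • v n := by
    intro k
    induction k with
    | zero => simp [S]
    | succ k ih => rw [Finset.sum_range_succ, ← ih]
  refine ⟨fun n => w n (S n), fun k => ?_⟩
  rw [← hS]
  induction k with
  | zero => simp [S]
  | succ k ih =>
    have h1 : S (k + 1) = S k + (z k - (w k (S k) : ℂ)) • v k := rfl
    rw [h1, norm_add_sq (𝕜 := ℂ), Finset.sum_range_succ, mul_add]
    have h2 := hw k (S k)
    have h3 : ‖(z k - (w k (S k) : ℂ)) • v k‖ ^ 2 ≤ 4 * ‖v k‖ ^ 2 := by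
      rw [norm_smul, mul_pow]
      gcongr
      have h4 : ‖z k - (w k (S k) : ℂ)‖ ≤ 2 := by
        refine (norm_sub_le _ _).trans ?_
        rw [Circle.norm_coe]
        linarith [hz k]
      nlinarith [norm_nonneg (z k - (w k (S k) : ℂ))]
    have h5 : RCLike.re (inner ℂ (S k) ((z k - (w k (S k) : ℂ)) • v k)) ≤ 0 := h2
    linarith

end Greedy

/-! ### Dirichlet series with bounded partial sums at the origin -/

section Abel

/-- `n^{-w}`, written as an exponential. -/
noncomputable def expLog (w : ℂ) (n : ℕ) : ℂ := Complex.exp (-w * (Real.log n : ℝ))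

theorem norm_expLog (w : ℂ) (n : ℕ) : ‖expLog w n‖ = Real.exp (-w.re * Real.log n) := by
  rw [expLog, Complex.norm_exp, Complex.re_mul_ofReal, Complex.neg_re]

theorem norm_expLog_le_rpow {w : ℂ} {δ : ℝ} (hw : δ ≤ w.re) {n : ℕ} (hn : 1 ≤ n) :
    ‖expLog w n‖ ≤ (n : ℝ) ^ (-δ) := by
  have hn' : (1 : ℝ) ≤ n := by exact_mod_cast hn
  rw [norm_expLog, Real.rpow_def_of_pos (by linarith), mul_comm]
  gcongr

theorem norm_expLog_sub_le {w : ℂ} {δ : ℝ} (hδ : 0 ≤ δ) (hw : δ ≤ w.re) {n : ℕ} (hn : 1 ≤ n) :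
    ‖expLog w n - expLog w (n + 1)‖ ≤ ‖w‖ * (n : ℝ) ^ (-(1 + δ)) := by
  have hn' : (1 : ℝ) ≤ n := by exact_mod_cast hn
  have hn0 : (0 : ℝ) < n := by linarith
  have h := (convex_Icc (n : ℝ) (n + 1)).norm_image_sub_le_of_norm_hasDerivWithin_le
    (f := fun x : ℝ => Complex.exp (-w * (Real.log x : ℝ)))
    (f' := fun x : ℝ => Complex.exp (-w * (Real.log x : ℝ)) * (-w * (x⁻¹ : ℝ)))
    (C := ‖w‖ * (n : ℝ) ^ (-(1 + δ))) (fun x hx => ?_) (fun x hx => ?_)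
    (x := (n : ℝ) + 1) (y := n) ⟨by linarith, le_rfl⟩ ⟨le_rfl, by linarith⟩
  · simpa [expLog, abs_of_pos] using h
  · have hx0 : x ≠ 0 := by linarith [hx.1]
    exact ((((Real.hasDerivAt_log hx0).ofReal_comp).const_mul (-w)).cexp).hasDerivWithinAt
  · have hx0 : 0 < x := by linarith [hx.1]
    have hx1 : 1 ≤ x := by linarith [hx.1]
    rw [norm_mul, Complex.norm_exp, Complex.re_mul_ofReal, Complex.neg_re, norm_mul, norm_neg,
      Complex.norm_real, Real.norm_of_nonneg (inv_pos.mpr hx0).le]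
    have h1 : Real.exp (-w.re * Real.log x) ≤ (n : ℝ) ^ (-δ) := by
      rw [Real.rpow_def_of_pos hn0, mul_comm]
      apply Real.exp_le_exp.mpr
      have h2 : Real.log n ≤ Real.log x := Real.log_le_log hn0 hx.1
      have h3 : 0 ≤ Real.log n := Real.log_nonneg hn'
      nlinarith
    have h4 : x⁻¹ ≤ (n : ℝ)⁻¹ := by gcongr; exact hx.1
    calc _ ≤ (n : ℝ) ^ (-δ) * (‖w‖ * (n : ℝ)⁻¹) := by gcongr
      _ = ‖w‖ * (n : ℝ) ^ (-(1 + δ)) := by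
        rw [neg_add, Real.rpow_add hn0, Real.rpow_neg_one]
        ring

theorem sum_mul_eq_abel (c e : ℕ → ℂ) (k : ℕ) :
    ∑ n ∈ Finset.range k, c n * e n = (∑ n ∈ Finset.range k, c n) * e k +
      ∑ n ∈ Finset.range k, (∑ i ∈ Finset.range (n + 1), c i) * (e n - e (n + 1)) := by
  induction k with
  | zero => simp
  | succ k ih =>
    rw [Finset.sum_range_succ, ih, Finset.sum_range_succ (fun n => (∑ i ∈ Finset.range (n + 1), c i)
      * (e n - e (n + 1))), Finset.sum_range_succ c]
    ring

/-- A Dirichlet series with partial sums bounded by `B` at the origin converges uniformly on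
bounded sets of a half-plane `Re w ≥ δ > 0`, to a limit which is `O(B)`. -/
theorem exists_tendstoUniformlyOn_dirichlet {c : ℕ → ℂ} (hc0 : c 0 = 0) {B : ℝ}
    (hB : ∀ k, ‖∑ n ∈ Finset.range k, c n‖ ≤ B) :
    ∃ F : ℂ → ℂ, ∀ δ R : ℝ, 0 < δ → 0 ≤ R →
      TendstoUniformlyOn (fun k w => ∑ n ∈ Finset.range k, c n * expLog w n) F atTop
        {w : ℂ | δ ≤ w.re ∧ ‖w‖ ≤ R} ∧
      ∀ w : ℂ, δ ≤ w.re → ‖w‖ ≤ R → ‖F w‖ ≤ B * (R * ∑' n : ℕ, (n : ℝ) ^ (-(1 + δ))) := by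
  have hB0 : 0 ≤ B := (norm_nonneg _).trans (hB 0)
  refine ⟨fun w => ∑' n : ℕ, (∑ i ∈ Finset.range (n + 1), c i) *
    (expLog w n - expLog w (n + 1)), fun δ R hδ hR => ?_⟩
  have hsum : Summable fun n : ℕ => (n : ℝ) ^ (-(1 + δ)) :=
    Real.summable_nat_rpow.mpr (by linarith)
  have hbound : ∀ (n : ℕ) (w : ℂ), w ∈ {w : ℂ | δ ≤ w.re ∧ ‖w‖ ≤ R} →
      ‖(∑ i ∈ Finset.range (n + 1), c i) * (expLog w n - expLog w (n + 1))‖ ≤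
        B * (R * (n : ℝ) ^ (-(1 + δ))) := by
    intro n w hw
    rcases Nat.eq_zero_or_pos n with rfl | hn
    · simp [hc0]
      positivity
    · rw [norm_mul]
      gcongr
      · exact hB _
      · refine (norm_expLog_sub_le hδ.le hw.1 hn).trans ?_
        gcongr
        exact hw.2
  have hsum2 : Summable fun n : ℕ => B * (R * (n : ℝ) ^ (-(1 + δ))) :=
    (hsum.mul_left R).mul_left B
  refine ⟨?_, fun w hw1 hw2 => ?_⟩
  · have h1 := tendstoUniformlyOn_tsum_nat hsum2 hbound
    have h2 : TendstoUniformlyOn (fun (k : ℕ) (w : ℂ) => (∑ n ∈ Finset.range k, c n) * expLog w k)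
        (fun _ => 0) atTop {w : ℂ | δ ≤ w.re ∧ ‖w‖ ≤ R} := by
      rw [Metric.tendstoUniformlyOn_iff]
      intro ε hε
      have h3 : Tendsto (fun k : ℕ => B * (k : ℝ) ^ (-δ)) atTop (𝓝 (B * 0)) :=
        ((tendsto_rpow_neg_atTop hδ).comp tendsto_natCast_atTop_atTop).const_mul B
      rw [mul_zero] at h3
      filter_upwards [h3.eventually_lt_const hε, eventually_ge_atTop 1] with k hk hk1 w hw
      rw [dist_zero_left, norm_mul]
      refine lt_of_le_of_lt ?_ hk
      gcongr
      · exact hB k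
      · exact norm_expLog_le_rpow hw.1 hk1
    have h4 := h2.add h1
    refine (h4.congr (Eventually.of_forall fun k w _ => ?_)).congr_right fun w _ => ?_
    · exact (sum_mul_eq_abel c (expLog w) k).symm
    · simp
  · refine (tsum_of_norm_bounded hsum2.hasSum fun n => hbound n w ⟨hw1, hw2⟩).trans ?_
    rw [tsum_mul_left, tsum_mul_left]

end Abel

/-! ### The space `H(D)` -/

section HolFun

theorem isOpen_verticalStrip (σ₁ σ₂ : ℝ) : IsOpen (verticalStrip σ₁ σ₂) :=
  (isOpen_lt continuous_const Complex.continuous_re).inter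
    (isOpen_lt Complex.continuous_re continuous_const)

/-- Convergence in `H(D)` is uniform convergence on compact sets. -/
theorem HolFun.tendsto_iff {D : Set ℂ} {ι : Type*} {l : Filter ι} {f : ι → HolFun D}
    {g : HolFun D} : Tendsto f l (𝓝 g) ↔ ∀ K : Set D, IsCompact K →
      TendstoUniformlyOn (fun i s => (f i : C(D, ℂ)) s) (fun s => (g : C(D, ℂ)) s) l K := by
  rw [tendsto_subtype_rng, ContinuousMap.tendsto_iff_forall_isCompact_tendstoUniformlyOn]

/-- A locally uniform limit of holomorphic functions, as an element of `H(D)`. -/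
theorem HolFun.exists_tendsto {D : Set ℂ} (hD : IsOpen D) {f : ℕ → HolFun D} {F : D → ℂ}
    (h : ∀ K : Set D, IsCompact K →
      TendstoUniformlyOn (fun i s => (f i : C(D, ℂ)) s) F atTop K) :
    ∃ g : HolFun D, (∀ s, (g : C(D, ℂ)) s = F s) ∧ Tendsto f atTop (𝓝 g) := by
  have : LocallyCompactSpace D := hD.locallyCompactSpace
  have hloc : TendstoLocallyUniformly (fun i s => (f i : C(D, ℂ)) s) F atTop :=
    tendstoLocallyUniformly_iff_forall_isCompact.mpr h
  have hcont : Continuous F :=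
    hloc.continuous (Eventually.of_forall fun i => (f i : C(D, ℂ)).continuous).frequently
  choose e hed he using fun i => (f i).2
  let F' : ℂ → ℂ := Function.extend Subtype.val F 0
  have hF' : ∀ s : D, F' s = F s := fun s => Subtype.val_injective.extend_apply F 0 s
  have hdiff : DifferentiableOn ℂ F' D := by
    refine TendstoLocallyUniformlyOn.differentiableOn (F := e) (φ := atTop) ?_
      (Eventually.of_forall hed) hD
    rw [tendstoLocallyUniformlyOn_iff_tendstoLocallyUniformly_comp_coe]
    refine (hloc.congr fun i s => (he i s).symm).congr_right fun s => ?_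
    exact (hF' s).symm
  refine ⟨⟨⟨F, hcont⟩, F', hdiff, hF'⟩, fun s => rfl, ?_⟩
  exact HolFun.tendsto_iff.mpr h

theorem exists_bounds_of_isCompact {σ₁ σ₂ : ℝ} {K : Set (verticalStrip σ₁ σ₂)}
    (hK : IsCompact K) : ∃ δ R : ℝ, 0 < δ ∧ 0 ≤ R ∧ ∀ s ∈ K,
      δ ≤ ((s : ℂ) - σ₁).re ∧ ‖(s : ℂ) - σ₁‖ ≤ R := by
  rcases K.eq_empty_or_nonempty with rfl | hne
  · exact ⟨1, 0, one_pos, le_rfl, by simp⟩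
  · obtain ⟨s₀, -, hs₀⟩ := hK.exists_isMinOn hne
      (f := fun s : verticalStrip σ₁ σ₂ => ((s : ℂ) - σ₁).re) (by fun_prop)
    obtain ⟨s₁, -, hs₁⟩ := hK.exists_isMaxOn hne
      (f := fun s : verticalStrip σ₁ σ₂ => ‖(s : ℂ) - σ₁‖) (by fun_prop)
    refine ⟨_, _, ?_, norm_nonneg ((s₁ : ℂ) - σ₁), fun s hs => ⟨hs₀ hs, hs₁ hs⟩⟩
    have := s₀.2.1
    simp only [Complex.sub_re, Complex.ofReal_re]
    linarith

end HolFun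

/-! ### The Euler product and the local factors -/

theorem natCast_cpow_eq_exp {n : ℕ} (hn : n ≠ 0) (z : ℂ) :
    (n : ℂ) ^ z = Complex.exp (z * (Real.log n : ℝ)) := by
  rw [Complex.cpow_def_of_ne_zero (by exact_mod_cast hn), ← Complex.natCast_log, mul_comm]

theorem natCast_cpow_neg_mul {n : ℕ} (hn : n ≠ 0) (k : ℕ) (s : ℂ) :
    (n : ℂ) ^ (-(k : ℂ) * s) = expLog s n ^ k := by
  rw [natCast_cpow_eq_exp hn, expLog, ← Complex.exp_nat_mul]
  congr 1
  ring

namespace SelbergClass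

variable (F : SelbergClass)

/-- The coefficients of `log L` as a function on `ℕ`, supported on the prime powers. -/
noncomputable def logCoeff (n : ℕ) : ℂ := by
  classical exact if IsPrimePow n then F.b n else 0

theorem logCoeff_prime_pow {p k : ℕ} (hp : p.Prime) (hk : k ≠ 0) :
    F.logCoeff (p ^ k) = F.b (p ^ k) := by
  rw [logCoeff, if_pos (hp.isPrimePow.pow hk)]

theorem exists_LSeriesHasSum_logCoeff {s : ℂ} (hs : 1 < s.re) :
    LSeriesSummable F.logCoeff s ∧ F.L s = Complex.exp (LSeries F.logCoeff s) := by
  obtain ⟨l, hl, hL⟩ := F.euler s hs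
  have h1 : HasSum ((fun n : {n : ℕ // IsPrimePow n} => LSeries.term F.logCoeff s n)) l := by
    rw [← Nat.Primes.prodNatEquiv.hasSum_iff]
    convert hl using 2 with q
    obtain ⟨p, k⟩ := q
    have hp0 : (p : ℕ) ≠ 0 := p.2.ne_zero
    have hpk : (p : ℕ) ^ (k + 1) ≠ 0 := pow_ne_zero _ hp0
    simp only [Function.comp, Nat.Primes.prodNatEquiv_apply]
    rw [LSeries.term_of_ne_zero hpk, F.logCoeff_prime_pow p.2 (Nat.succ_ne_zero k),
      natCast_cpow_eq_exp hpk, natCast_cpow_eq_exp hp0, div_eq_mul_inv, ← Complex.exp_neg,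
      Nat.cast_pow, Real.log_pow]
    congr 2
    push_cast
    ring
  have h2 : HasSum (LSeries.term F.logCoeff s) l := by
    refine (hasSum_subtype_iff_of_support_subset (s := {n | IsPrimePow n}) fun n hn => ?_).mp h1
    by_contra h
    refine hn ?_
    have : F.logCoeff n = 0 := if_neg h
    simp [LSeries.term, this]
  have h3 : LSeriesHasSum F.logCoeff s l := h2
  exact ⟨h3.LSeriesSummable, by rw [h3.LSeries_eq, hL]⟩

theorem abscissa_a_le : LSeries.abscissaOfAbsConv F.a ≤ ((1 : ℝ) : EReal) :=
  LSeries.abscissaOfAbsConv_le_of_forall_lt_LSeriesSummable fun y hy =>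
    (F.dirichlet y (by simpa using hy)).LSeriesSummable

theorem abscissa_logCoeff_le : LSeries.abscissaOfAbsConv F.logCoeff ≤ ((1 : ℝ) : EReal) :=
  LSeries.abscissaOfAbsConv_le_of_forall_lt_LSeriesSummable fun y hy =>
    (F.exists_LSeriesHasSum_logCoeff (by simpa using hy)).1

theorem LSeries_a_eq_exp {s : ℂ} (hs : 1 < s.re) :
    LSeries F.a s = Complex.exp (LSeries F.logCoeff s) := by
  rw [(F.dirichlet s hs).LSeries_eq, (F.exists_LSeriesHasSum_logCoeff hs).2]

theorem a_one : F.a 1 = 1 := by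
  have h1 := LSeries.tendsto_atTop (F.abscissa_a_le.trans_lt (EReal.coe_lt_top 1))
  have h2 := LSeries.tendsto_atTop (F.abscissa_logCoeff_le.trans_lt (EReal.coe_lt_top 1))
  have h3 : F.logCoeff 1 = 0 := if_neg not_isPrimePow_one
  rw [h3] at h2
  have h4 := (Complex.continuous_exp.tendsto 0).comp h2
  rw [Complex.exp_zero] at h4
  refine tendsto_nhds_unique h1 (h4.congr' ?_)
  filter_upwards [eventually_gt_atTop 1] with x hx
  exact (F.LSeries_a_eq_exp (by simpa using hx)).symm

/-- The logarithmic derivative of `L = exp (log L)`, in terms of coefficients. -/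
theorem log_mul_a_eq {n : ℕ} (hn : n ≠ 0) :
    LSeries.logMul F.a n = LSeries.convolution F.a (LSeries.logMul F.logCoeff) n := by
  have ha := F.abscissa_a_le
  have hb := F.abscissa_logCoeff_le
  have hlt : ((1 : ℝ) : EReal) < ⊤ := EReal.coe_lt_top 1
  refine LSeries.eq_of_LSeries_eventually_eq ?_ ?_ ?_ hn
  · rw [LSeries.abscissaOfAbsConv_logMul]
    exact ha.trans_lt hlt
  · refine (LSeries.abscissaOfAbsConv_convolution_le _ _).trans_lt (max_lt (ha.trans_lt hlt) ?_)
    rw [LSeries.abscissaOfAbsConv_logMul]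
    exact hb.trans_lt hlt
  · filter_upwards [eventually_gt_atTop 1] with x hx
    have hx' : ((1 : ℝ) : EReal) < ((x : ℂ).re : EReal) := by
      rw [Complex.ofReal_re]; exact_mod_cast hx
    have hax := ha.trans_lt hx'
    have hbx := hb.trans_lt hx'
    rw [LSeries_convolution hax (by rwa [LSeries.abscissaOfAbsConv_logMul])]
    have h1 := LSeries_hasDerivAt hax
    have h2 := (LSeries_hasDerivAt hbx).cexp
    have h3 : LSeries F.a =ᶠ[𝓝 (x : ℂ)] fun s => Complex.exp (LSeries F.logCoeff s) := by
      filter_upwards [(isOpen_lt continuous_const Complex.continuous_re).mem_nhds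
        (show (1 : ℝ) < (x : ℂ).re by simpa using hx)] with s hs
      exact F.LSeries_a_eq_exp hs
    have h4 := h1.unique (h2.congr_of_eventuallyEq h3)
    rw [← F.LSeries_a_eq_exp (by simpa using hx), mul_neg, neg_inj] at h4
    exact h4

/-- Newton's identities relating the `a(p^k)` to the `b(p^k)`. -/
theorem natCast_mul_a_prime_pow {p : ℕ} (hp : p.Prime) (k : ℕ) :
    (k : ℂ) * F.a (p ^ k) =
      ∑ i ∈ Finset.range (k + 1), F.a (p ^ (k - i)) * (i * F.b (p ^ i)) := by
  have h := F.log_mul_a_eq (pow_ne_zero k hp.ne_zero)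
  rw [LSeries.convolution_def] at h
  simp only [LSeries.logMul] at h
  rw [Nat.sum_divisorsAntidiagonal' (f := fun i j => F.a i * (Complex.log j * F.logCoeff j)),
    Nat.sum_divisors_prime_pow hp] at h
  have hlog : Complex.log (p : ℂ) ≠ 0 := by
    rw [← Complex.natCast_log]
    exact_mod_cast (Real.log_pos (by exact_mod_cast hp.one_lt)).ne'
  have hpow : ∀ i : ℕ, Complex.log ((p ^ i : ℕ) : ℂ) = i * Complex.log p := by
    intro i
    rw [← Complex.natCast_log, ← Complex.natCast_log, Nat.cast_pow, Real.log_pow]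
    push_cast
    ring
  rw [hpow] at h
  refine mul_left_cancel₀ hlog ?_
  rw [← mul_assoc, mul_comm (Complex.log (p : ℂ)), h, Finset.mul_sum]
  refine Finset.sum_congr rfl fun i hi => ?_
  rw [Nat.pow_div (Nat.lt_succ_iff.mp (Finset.mem_range.mp hi)) hp.pos, hpow]
  rcases Nat.eq_zero_or_pos i with rfl | hi0
  · simp
  · rw [F.logCoeff_prime_pow hp hi0.ne']
    ring

theorem b_prime {p : ℕ} (hp : p.Prime) : F.b p = F.a p := by
  have h := F.natCast_mul_a_prime_pow hp 1
  simp [Finset.sum_range_succ, F.a_one] at h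
  exact h.symm

theorem exists_norm_a_le {ε : ℝ} (hε : 0 < ε) :
    ∃ C : ℝ, ∀ n : ℕ, 1 ≤ n → ‖F.a n‖ ≤ C * (n : ℝ) ^ ε := by
  obtain ⟨C, hC⟩ := (F.ramanujan ε hε).bound
  obtain ⟨N, hN⟩ := eventually_atTop.mp hC
  refine ⟨|C| + ∑ n ∈ Finset.range N, ‖F.a n‖, fun n hn => ?_⟩
  have hn1 : 1 ≤ (n : ℝ) ^ ε := Real.one_le_rpow (by exact_mod_cast hn) hε.le
  have hsum : 0 ≤ ∑ n ∈ Finset.range N, ‖F.a n‖ := Finset.sum_nonneg fun _ _ => norm_nonneg _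
  rcases lt_or_ge n N with h | h
  · have h1 : ‖F.a n‖ ≤ ∑ n ∈ Finset.range N, ‖F.a n‖ :=
      Finset.single_le_sum (f := fun n => ‖F.a n‖) (fun _ _ => norm_nonneg _)
        (Finset.mem_range.mpr h)
    calc ‖F.a n‖ ≤ (|C| + ∑ n ∈ Finset.range N, ‖F.a n‖) * 1 := by
          linarith [abs_nonneg C]
      _ ≤ _ := by gcongr
  · have h1 := hN n h
    rw [Real.norm_of_nonneg (by positivity)] at h1
    refine h1.trans ?_
    gcongr
    linarith [le_abs_self C]

/-- For fixed `k` the Ramanujan hypothesis passes from the `a(p^k)` to the `b(p^k)`, by induction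
with Newton's identities. -/
theorem exists_norm_b_prime_pow_le (k : ℕ) (hk : 1 ≤ k) :
    ∀ ε : ℝ, 0 < ε → ∃ C : ℝ, 0 ≤ C ∧ ∀ p : ℕ, p.Prime → ‖F.b (p ^ k)‖ ≤ C * (p : ℝ) ^ ε := by
  induction k using Nat.strong_induction_on with
  | _ k ih =>
    intro ε hε
    have hk0 : (0 : ℝ) < k := by exact_mod_cast hk
    obtain ⟨A, hA⟩ := F.exists_norm_a_le (show 0 < ε / (2 * k) by positivity)
    have hA0 : 0 ≤ A := by
      have := hA 1 le_rfl
      simp only [Nat.cast_one, Real.one_rpow, mul_one] at this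
      exact (norm_nonneg _).trans this
    have hB : ∀ i : ℕ, ∃ C : ℝ, 0 ≤ C ∧ (i ∈ Finset.range k → ∀ p : ℕ, p.Prime →
        i * ‖F.b (p ^ i)‖ ≤ C * (p : ℝ) ^ (ε / 2)) := by
      intro i
      rcases Nat.eq_zero_or_pos i with rfl | hi
      · exact ⟨0, le_rfl, fun _ p _ => by simp⟩
      · by_cases hik : i ∈ Finset.range k
        · obtain ⟨C, hC0, hC⟩ := ih i (Finset.mem_range.mp hik) hi (ε / 2) (by positivity)
          refine ⟨i * C, by positivity, fun _ p hp => ?_⟩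
          rw [mul_assoc]
          gcongr
          exact hC p hp
        · exact ⟨0, le_rfl, fun h => absurd h hik⟩
    choose B hB0 hB using hB
    have hapow : ∀ p : ℕ, p.Prime → ∀ i ≤ k, ‖F.a (p ^ i)‖ ≤ A * (p : ℝ) ^ (ε / 2) := by
      intro p hp i hi
      have hp1 : (1 : ℝ) ≤ p := by exact_mod_cast hp.one_le
      refine (hA _ (Nat.one_le_pow _ _ hp.pos)).trans ?_
      gcongr
      rw [Nat.cast_pow, ← Real.rpow_natCast, ← Real.rpow_mul (by linarith)]
      apply Real.rpow_le_rpow_of_exponent_le hp1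
      rw [mul_div_assoc', div_le_div_iff₀ (by positivity) two_pos]
      have : (i : ℝ) ≤ k := by exact_mod_cast hi
      nlinarith
    refine ⟨k * A + ∑ i ∈ Finset.range k, A * B i,
      add_nonneg (by positivity) (Finset.sum_nonneg fun i _ => mul_nonneg hA0 (hB0 i)),
      fun p hp => ?_⟩
    have hp1 : (1 : ℝ) ≤ p := by exact_mod_cast hp.one_le
    have hp0 : (0 : ℝ) < p := by linarith
    have hnewton := F.natCast_mul_a_prime_pow hp k
    rw [Finset.sum_range_succ, Nat.sub_self, pow_zero, F.a_one, one_mul] at hnewton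
    have h1 : (k : ℂ) * F.b (p ^ k) = k * F.a (p ^ k) -
        ∑ i ∈ Finset.range k, F.a (p ^ (k - i)) * (i * F.b (p ^ i)) := by
      rw [hnewton]; ring
    have h2 : (k : ℝ) * ‖F.b (p ^ k)‖ ≤
        (k * A + ∑ i ∈ Finset.range k, A * B i) * (p : ℝ) ^ ε := by
      have h3 : (k : ℝ) * ‖F.b (p ^ k)‖ = ‖(k : ℂ) * F.b (p ^ k)‖ := by
        rw [norm_mul, Complex.norm_natCast]
      have hhalf : (p : ℝ) ^ (ε / 2) * (p : ℝ) ^ (ε / 2) = (p : ℝ) ^ ε := by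
        rw [← Real.rpow_add hp0]; congr 1; ring
      have hle : (p : ℝ) ^ (ε / 2) ≤ (p : ℝ) ^ ε :=
        Real.rpow_le_rpow_of_exponent_le hp1 (by linarith)
      rw [h3, h1, add_mul, Finset.sum_mul]
      refine (norm_sub_le _ _).trans (add_le_add ?_ ?_)
      · rw [norm_mul, Complex.norm_natCast, mul_assoc]
        gcongr
        exact (hapow p hp k le_rfl).trans (by gcongr)
      · refine (norm_sum_le _ _).trans (Finset.sum_le_sum fun i hi => ?_)
        rw [norm_mul, norm_mul, Complex.norm_natCast, ← hhalf]
        calc _ ≤ (A * (p : ℝ) ^ (ε / 2)) * (B i * (p : ℝ) ^ (ε / 2)) :=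
              mul_le_mul (hapow p hp _ (Nat.sub_le _ _)) (hB i hi p hp) (by positivity)
                (by positivity)
          _ = _ := by ring
    have hk1 : (1 : ℝ) ≤ k := by exact_mod_cast hk
    refine le_trans ?_ h2
    exact le_mul_of_one_le_left (norm_nonneg _) hk1

/-- The terms with `k ≥ 2` of the local factors are summable over all prime powers to the right of
`1/2`: for large `k` because of the bound on the `b(p^k)`, for small `k` because of the Ramanujan
hypothesis. -/
theorem exists_higher_bound {σ : ℝ} (hσ : 1 / 2 < σ) :
    ∃ (τ : ℝ) (v : ℕ → ℝ), 1 < τ ∧ (∀ k, 0 ≤ v k) ∧ Summable v ∧ ∀ p : ℕ, p.Prime → ∀ k : ℕ,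
      ‖F.b (p ^ (k + 2))‖ * (p : ℝ) ^ (-(((k + 2 : ℕ) : ℝ) * σ)) ≤ v k * (p : ℝ) ^ (-τ) := by
  obtain ⟨θ, C, hθ, hC⟩ := F.euler_bound
  have hd : 0 < σ - θ := by linarith
  obtain ⟨K, hK⟩ := exists_nat_gt (1 / (σ - θ))
  rw [div_lt_iff₀ hd] at hK
  set ε := (2 * σ - 1) / 2 with hε
  have hε0 : 0 < ε := by rw [hε]; linarith
  choose B hB0 hB using fun k : ℕ =>
    F.exists_norm_b_prime_pow_le (k + 2) (by omega) ε hε0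
  set x : ℝ := 2 ^ (-(σ - θ)) with hx
  have hx0 : 0 < x := by positivity
  have hx1 : x < 1 := Real.rpow_lt_one_of_one_lt_of_neg (by norm_num) (by linarith)
  refine ⟨min (2 * σ - ε) (K * (σ - θ)),
    fun k => if k + 2 < K then B k else |C| * x ^ (k + 2 - K), ?_, ?_, ?_, ?_⟩
  · exact lt_min (by rw [hε]; linarith) hK
  · intro k
    beta_reduce
    split_ifs
    · exact hB0 k
    · positivity
  · rw [← summable_nat_add_iff K]
    have hg : Summable fun k : ℕ => |C| * (x ^ k * x ^ 2) :=
      ((summable_geometric_of_lt_one hx0.le hx1).mul_right _).mul_left _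
    refine hg.congr fun k => ?_
    rw [if_neg (by omega), ← pow_add]
    congr 2
    omega
  · intro p hp k
    have hp2 : (2 : ℝ) ≤ p := by exact_mod_cast hp.two_le
    have hp1 : (1 : ℝ) ≤ p := by linarith
    have hp0 : (0 : ℝ) < p := by linarith
    beta_reduce
    split_ifs with hkK
    · calc _ ≤ B k * (p : ℝ) ^ ε * (p : ℝ) ^ (-(2 * σ)) := by
            gcongr
            · exact mul_nonneg (hB0 k) (by positivity)
            · exact hB k p hp
            · push_cast
              linarith [(Nat.cast_nonneg k : (0 : ℝ) ≤ k)]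
        _ = B k * (p : ℝ) ^ (-(2 * σ - ε)) := by
            rw [mul_assoc, ← Real.rpow_add hp0]; congr 2; ring
        _ ≤ _ := by
            have := hB0 k
            gcongr
            · exact min_le_left _ _
    · have hkK' : K ≤ k + 2 := by omega
      calc _ ≤ |C| * (p : ℝ) ^ (((k + 2 : ℕ) : ℝ) * θ) * (p : ℝ) ^ (-(((k + 2 : ℕ) : ℝ) * σ)) := by
            gcongr
            refine (hC p (k + 2) hp (by omega)).trans ?_
            gcongr
            exact le_abs_self C
        _ = |C| * ((p : ℝ) ^ (-((k + 2 - K : ℕ) * (σ - θ))) * (p : ℝ) ^ (-(K * (σ - θ)))) := by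
            rw [mul_assoc, ← Real.rpow_add hp0, ← Real.rpow_add hp0, Nat.cast_sub hkK']
            congr 2
            ring
        _ ≤ |C| * (x ^ (k + 2 - K) *
              (p : ℝ) ^ (-(min (2 * σ - ε) (K * (σ - θ))))) := by
            gcongr
            · rw [hx, ← Real.rpow_natCast, ← Real.rpow_mul (by norm_num),
                Real.rpow_neg hp0.le, ← mul_comm (((k + 2 - K : ℕ) : ℝ)), mul_neg,
                Real.rpow_neg (by norm_num)]
              gcongr
            · exact min_le_right _ _
        _ = _ := by ring

/-- The local factor `g_p(s, ω)` exists in `H(D)`, and differs little from its first term. -/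
theorem exists_localLog {σ₁ σ₂ τ : ℝ} {v : ℕ → ℝ} (hv : Summable v)
    (hb : ∀ p : ℕ, p.Prime → ∀ k : ℕ,
      ‖F.b (p ^ (k + 2))‖ * (p : ℝ) ^ (-(((k + 2 : ℕ) : ℝ) * σ₁)) ≤ v k * (p : ℝ) ^ (-τ))
    {p : ℕ} (hp : p.Prime) (ω : Circle) :
    ∃ g : HolFun (verticalStrip σ₁ σ₂), (∀ s : verticalStrip σ₁ σ₂,
      HasSum (fun k : ℕ => F.b (p ^ (k + 1)) * (ω : ℂ) ^ (k + 1) *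
        (p : ℂ) ^ (-((k + 1 : ℕ) : ℂ) * (s : ℂ))) ((g : C(verticalStrip σ₁ σ₂, ℂ)) s)) ∧
      ∀ s : verticalStrip σ₁ σ₂, ‖(g : C(verticalStrip σ₁ σ₂, ℂ)) s -
        ω * (F.a p * expLog s p)‖ ≤ (∑' k, v k) * (p : ℝ) ^ (-τ) := by
  have hp1 : (1 : ℝ) ≤ p := by exact_mod_cast hp.one_le
  have hp0 : (0 : ℝ) < p := by linarith
  set t : ℕ → ℂ → ℂ := fun k s => F.b (p ^ (k + 2)) * (ω : ℂ) ^ (k + 2) * expLog s p ^ (k + 2)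
    with ht
  have hbound : ∀ (k : ℕ) (s : ℂ), s ∈ verticalStrip σ₁ σ₂ → ‖t k s‖ ≤ v k * (p : ℝ) ^ (-τ) := by
    intro k s hs
    refine le_trans ?_ (hb p hp k)
    rw [ht, norm_mul, norm_mul, norm_pow, norm_pow, Circle.norm_coe, one_pow, mul_one]
    gcongr
    calc ‖expLog s p‖ ^ (k + 2) ≤ ((p : ℝ) ^ (-σ₁)) ^ (k + 2) := by
          gcongr
          exact norm_expLog_le_rpow hs.1.le hp.one_le
      _ = _ := by
          rw [← Real.rpow_natCast, ← Real.rpow_mul hp0.le]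
          congr 1
          ring
  have hdiffE : Differentiable ℂ fun s => expLog s p := by
    unfold expLog
    fun_prop
  have hdiff : DifferentiableOn ℂ (fun s => ∑' k, t k s) (verticalStrip σ₁ σ₂) :=
    Complex.differentiableOn_tsum_of_summable_norm (hv.mul_right _)
      (fun k => ((hdiffE.pow (k + 2)).const_mul _).differentiableOn) (isOpen_verticalStrip σ₁ σ₂)
      hbound
  set f : ℂ → ℂ := fun s => ω * (F.a p * expLog s p) + ∑' k, t k s with hf
  have hfd : DifferentiableOn ℂ f (verticalStrip σ₁ σ₂) :=
    ((hdiffE.const_mul _).const_mul _).differentiableOn.add hdiff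
  refine ⟨⟨⟨fun s => f s, hfd.continuousOn.domRestrict⟩, f, hfd, fun _ => rfl⟩, fun s => ?_,
    fun s => ?_⟩
  · have h1 : HasSum (fun k => t k s) (∑' k, t k s) :=
      (Summable.of_norm_bounded (hv.mul_right _) fun k => hbound k s s.2).hasSum
    have h2 : HasSum (fun k : ℕ => F.b (p ^ (k + 1)) * (ω : ℂ) ^ (k + 1) *
        expLog s p ^ (k + 1)) (f s) := by
      rw [← hasSum_nat_add_iff' 1]
      simpa [hf, ht, F.b_prime hp, mul_comm, mul_left_comm] using h1
    simp only [natCast_cpow_neg_mul hp.ne_zero]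
    exact h2
  · change ‖f s - ω * (F.a p * expLog s p)‖ ≤ _
    rw [hf, add_sub_cancel_left, ← tsum_mul_right]
    exact tsum_of_norm_bounded (hv.mul_right _).hasSum fun k => hbound k s s.2

end SelbergClass

/-! ### The prime sums and the mean square -/

section PrimeSums

theorem sum_shortPrimes_eq {E : Type*} [AddCommGroup E] (f : ℕ → E) {κ : ℝ} (hκ : 0 < κ) (t : ℝ) :
    ∑ p ∈ shortPrimes κ t, f p =
      primeSum f (Real.exp (t + κ / t ^ 2)) - primeSum f (Real.exp t) := by
  have h1 : ∀ x : ℝ, primeSum f x = ∑ n ∈ Finset.Ioc 0 ⌊x⌋₊, if n.Prime then f n else 0 :=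
    fun x => Finset.sum_filter _ _
  have hle : ⌊Real.exp t⌋₊ ≤ ⌊Real.exp (t + κ / t ^ 2)⌋₊ := by
    gcongr
    have : 0 ≤ κ / t ^ 2 := by positivity
    linarith
  rw [h1, h1, ← Finset.sum_Ioc_consecutive _ (Nat.zero_le _) hle, add_sub_cancel_left, shortPrimes,
    Finset.sum_filter]

variable {m : ℕ} {L : Fin m → SelbergClass}

/-- Asymptotics of the sum of the `|a_k(p)|²` over the primes of a short interval, of which there
are about `κ e^t / t³`. -/
theorem SelbergStrongA.exists_tendsto (hA : SelbergStrongA L) :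
    ∃ c : Fin m → ℝ, (∀ k, 0 < c k) ∧ ∀ k κ, 0 < κ → Tendsto (fun t : ℝ =>
      (∑ p ∈ shortPrimes κ t, ‖(L k).a p‖ ^ 2) * (t ^ 3 * Real.exp (-t))) atTop
      (𝓝 (c k * κ)) := by
  choose c hc hO using hA
  refine ⟨fun k => c k 1, hc, fun k κ hκ => ?_⟩
  have hm : 0 < m := k.pos
  have h1 : (fun x : ℝ => ((primeSum (fun p => ‖(L k).a p‖ ^ 2) x : ℝ) : ℂ) -
      ∑ j ∈ Finset.range (2 * m + 1), ((c k (j + 1) : ℝ) : ℂ) * (x : ℂ) /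
        (Real.log x : ℂ) ^ (j + 1)) =O[atTop] fun x : ℝ => x / Real.log x ^ (2 * m + 2) := by
    refine (IsBigO.of_norm_left ((hO k).norm_left.congr_left fun x => ?_))
    rw [← Complex.norm_real]
    congr 1
    push_cast
    congr 1
    rw [← Finset.Ico_add_one_right_eq_Icc, Finset.sum_Ico_eq_sum_range]
    simp [add_comm]
  -- the error `x / (log x)^{2m+2}` is small enough on this scale because `m ≥ 1`
  have h2 := tendsto_increment (by omega) hκ h1 (by omega)
  have h3 := (Complex.continuous_re.tendsto _).comp h2
  rw [show ((((c k (0 + 1) : ℝ) : ℂ) * (κ : ℂ)).re) = c k 1 * κ by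
    rw [← Complex.ofReal_mul, Complex.ofReal_re]] at h3
  refine h3.congr fun t => ?_
  rw [sum_shortPrimes_eq _ hκ]
  simp only [Function.comp]
  rw [← Complex.ofReal_sub, ← Complex.ofReal_mul, Complex.ofReal_re]

theorem SelbergStrongB.tendsto (hB : SelbergStrongB L) (k l : Fin m) (κ : ℝ) (hkl : k ≠ l)
    (hκ : 0 < κ) : Tendsto (fun t : ℝ =>
      ‖∑ p ∈ shortPrimes κ t, (L k).a p * (starRingEnd ℂ) ((L l).a p)‖ *
        (t ^ 3 * Real.exp (-t))) atTop (𝓝 0) := by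
  obtain ⟨c, hO⟩ := hB k l hkl
  have hm : 0 < m := k.pos
  have h1 : (fun x : ℝ => primeSum (fun p => (L k).a p * (starRingEnd ℂ) ((L l).a p)) x -
      ∑ j ∈ Finset.range (2 * m + 1), (if j = 0 then 0 else c (j + 1)) * (x : ℂ) /
        (Real.log x : ℂ) ^ (j + 1)) =O[atTop] fun x : ℝ => x / Real.log x ^ (2 * m + 2) := by
    refine hO.congr_left fun x => ?_
    congr 1
    rw [← Finset.Ico_add_one_right_eq_Icc, Finset.sum_Ico_eq_sum_range, Finset.sum_range_succ']
    simp only [if_true, zero_mul, zero_div, add_zero]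
    refine Finset.sum_congr (by congr 1) fun j _ => ?_
    rw [if_neg (Nat.succ_ne_zero j), show 2 + j = j + 1 + 1 by ring]
  have h2 := (tendsto_increment (by omega) hκ h1 (by omega)).norm
  simp only [if_true, zero_mul, norm_zero] at h2
  refine h2.congr' ?_
  filter_upwards [eventually_gt_atTop 0] with t ht
  rw [sum_shortPrimes_eq _ hκ, norm_mul, Complex.norm_real, Real.norm_of_nonneg (by positivity)]

/-- Mean squares exist only to the right of `1/2`, as the sum of the `|a(p)|²` over `p ≤ x` is not
`O(x^θ)` for any `θ < 1`. -/
theorem half_lt_of_meanSquareAbscissa_lt {F : SelbergClass} {c : ℝ} (hc : 0 < c)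
    (h : Tendsto (fun t : ℝ =>
      (∑ p ∈ shortPrimes 1 t, ‖F.a p‖ ^ 2) * (t ^ 3 * Real.exp (-t))) atTop (𝓝 c))
    {σ₁ : ℝ} (hσ₁ : F.meanSquareAbscissa < (σ₁ : EReal)) : 1 / 2 < σ₁ := by
  by_contra! hle
  obtain ⟨_, ⟨σ₀, hσ₀, rfl⟩, hlt⟩ := sInf_lt_iff.mp hσ₁
  have hlt' : σ₀ < σ₁ := EReal.coe_lt_coe_iff.mp hlt
  set σ := (σ₀ + σ₁) / 2
  have hσ : σ < 1 / 2 := by simp only [σ]; linarith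
  have hms := (hσ₀ σ (by simp only [σ]; linarith) (by linarith)).1
  set u : ℕ → ℝ := fun n => ‖F.a n‖ ^ 2 / (n : ℝ) ^ (2 * σ) with hu
  have hsum : Summable u := (summable_nat_add_iff 1).mp hms
  have hu0 : ∀ n, 0 ≤ u n := fun n => by positivity
  set S := ∑' n, u n
  -- `σ` may be negative, in which case the `|a(p)|²` are bounded by a convergent sum already
  set d := max (2 * σ) 0 with hd
  have hd1 : d < 1 := max_lt (by linarith) one_pos
  have hd0 : 0 ≤ d := le_max_right _ _
  have hbound : ∀ᶠ t : ℝ in atTop,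
      (∑ p ∈ shortPrimes 1 t, ‖F.a p‖ ^ 2) * (t ^ 3 * Real.exp (-t)) ≤
        S * Real.exp d * (t ^ 3 * Real.exp (-(1 - d) * t)) := by
    filter_upwards [eventually_ge_atTop 1] with t ht
    have h1 : ∑ p ∈ shortPrimes 1 t, ‖F.a p‖ ^ 2 ≤ S * Real.exp (d * (t + 1)) := by
      calc ∑ p ∈ shortPrimes 1 t, ‖F.a p‖ ^ 2
          ≤ ∑ p ∈ shortPrimes 1 t, u p * Real.exp (d * (t + 1)) := by
            refine Finset.sum_le_sum fun p hp => ?_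
            simp only [shortPrimes, Finset.mem_filter, Finset.mem_Ioc] at hp
            have hp1 : (1 : ℝ) ≤ p := by exact_mod_cast hp.2.one_le
            have hp0 : (0 : ℝ) < p := by linarith
            have hpt : (p : ℝ) ≤ Real.exp (t + 1) := by
              refine ((Nat.le_floor_iff (Real.exp_pos _).le).mp hp.1.2).trans ?_
              gcongr
              rw [div_le_one (by positivity)]
              nlinarith
            have h2 : (p : ℝ) ^ (2 * σ) ≤ Real.exp (d * (t + 1)) := by
              calc (p : ℝ) ^ (2 * σ) ≤ (p : ℝ) ^ d :=
                    Real.rpow_le_rpow_of_exponent_le hp1 (le_max_left _ _)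
                _ ≤ (Real.exp (t + 1)) ^ d := by gcongr
                _ = _ := by rw [← Real.exp_mul, mul_comm]
            have h3 : ‖F.a p‖ ^ 2 = u p * (p : ℝ) ^ (2 * σ) := by
              simp only [hu]
              field_simp
            rw [h3]
            exact mul_le_mul_of_nonneg_left h2 (hu0 p)
        _ ≤ _ := by
            rw [← Finset.sum_mul]
            gcongr
            exact hsum.sum_le_tsum _ fun n _ => hu0 n
    calc _ ≤ S * Real.exp (d * (t + 1)) * (t ^ 3 * Real.exp (-t)) := by
          gcongr
      _ = S * Real.exp d * (t ^ 3 * Real.exp (-(1 - d) * t)) := by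
          have : Real.exp (d * (t + 1)) * Real.exp (-t) =
              Real.exp d * Real.exp (-(1 - d) * t) := by
            rw [← Real.exp_add, ← Real.exp_add]; congr 1; ring
          linear_combination (S * t ^ 3) * this
  have hlim : Tendsto (fun t : ℝ => S * Real.exp d * (t ^ 3 * Real.exp (-(1 - d) * t))) atTop
      (𝓝 0) := by
    have hb : 0 < 1 - d := by linarith
    have h1 := (Real.tendsto_pow_mul_exp_neg_atTop_nhds_zero 3).comp
      (tendsto_id.const_mul_atTop hb)
    have h2 := h1.const_mul (S * Real.exp d / (1 - d) ^ 3)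
    rw [mul_zero] at h2
    refine h2.congr fun t => ?_
    simp only [Function.comp, id, mul_pow, neg_mul]
    field_simp
  linarith [le_of_tendsto_of_tendsto h hlim hbound]

end PrimeSums

theorem exists_tail_sum_lt {u : ℕ → ℝ} (hu : Summable u) {ε : ℝ} (hε : 0 < ε) :
    ∃ N : ℕ, ∀ F : Finset ℕ, (∀ n ∈ F, N ≤ n) → ∑ n ∈ F, u n < ε := by
  obtain ⟨s, hs⟩ := summable_iff_vanishing_norm.mp hu ε hε
  refine ⟨s.sup id + 1, fun F hF => (le_abs_self _).trans_lt (hs F ?_)⟩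
  rw [Finset.disjoint_left]
  intro n hn hns
  have h1 : n ≤ s.sup id := Finset.le_sup (f := id) hns
  have h2 := hF n hn
  omega

/-- The vector of coefficients `(a_j(n) n^{-σ})_j`. -/
noncomputable def coeffVector {m : ℕ} (a : Fin m → ℕ → ℂ) (σ : ℝ) (n : ℕ) :
    EuclideanSpace ℂ (Fin m) :=
  WithLp.toLp 2 fun j => a j n * expLog σ n

theorem summable_sq_norm_coeffVector {m : ℕ} {a : Fin m → ℕ → ℂ}
    (hram : ∀ ε : ℝ, 0 < ε → ∀ j, ∃ C : ℝ, ∀ n : ℕ, 1 ≤ n → ‖a j n‖ ≤ C * (n : ℝ) ^ ε)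
    {σ : ℝ} (hσ : 1 / 2 < σ) : Summable fun n => ‖coeffVector a σ n‖ ^ 2 := by
  simp only [EuclideanSpace.norm_sq_eq, coeffVector]
  refine summable_sum fun j _ => ?_
  obtain ⟨C, hC⟩ := hram ((σ - 1 / 2) / 2) (by linarith) j
  have hs : Summable fun n : ℕ => C ^ 2 * (n : ℝ) ^ (-(σ + 1 / 2)) :=
    (Real.summable_nat_rpow.mpr (by linarith)).mul_left _
  refine Summable.of_norm_bounded_eventually_nat hs ?_
  filter_upwards [eventually_ge_atTop 1] with n hn
  have hn0 : (0 : ℝ) < n := by exact_mod_cast hn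
  have h1 : ‖a j n * expLog σ n‖ ≤ C * (n : ℝ) ^ ((σ - 1 / 2) / 2) * (n : ℝ) ^ (-σ) := by
    rw [norm_mul]
    gcongr
    · exact (norm_nonneg _).trans (hC n hn)
    · exact hC n hn
    · exact norm_expLog_le_rpow (by simp) hn
  rw [Real.norm_of_nonneg (by positivity)]
  calc ‖a j n * expLog σ n‖ ^ 2 ≤ (C * (n : ℝ) ^ ((σ - 1 / 2) / 2) * (n : ℝ) ^ (-σ)) ^ 2 := by
        gcongr
    _ = C ^ 2 * (n : ℝ) ^ (-(σ + 1 / 2)) := by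
        rw [mul_assoc, ← Real.rpow_add hn0, mul_pow, ← Real.rpow_mul_natCast hn0.le]
        congr 2
        push_cast
        ring

theorem expLog_mul_expLog (z w : ℂ) (n : ℕ) : expLog z n * expLog w n = expLog (z + w) n := by
  rw [expLog, expLog, expLog, ← Complex.exp_add]
  congr 1
  ring

theorem tendstoUniformlyOn_const_of_eventually_eq {α : Type*} {f : ℕ → α → ℂ} {g : α → ℂ}
    {K : Set α} (h : ∀ᶠ k in atTop, ∀ s, f k s = g s) : TendstoUniformlyOn f g atTop K := by
  rw [Metric.tendstoUniformlyOn_iff]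
  intro ε hε
  filter_upwards [h] with k hk s _
  rw [hk, dist_self]
  exact hε

theorem sum_primesUpTo {E : Type*} [AddCommMonoid E] (f : ℕ → E) (N : ℕ) :
    ∑ p ∈ primesUpTo N, f p = ∑ n ∈ Finset.range (N + 1), if n.Prime then f n else 0 := by
  have h : ∑ p ∈ primesUpTo N, f p = ∑ n ∈ (Finset.Icc 1 N).filter Nat.Prime, f n :=
    Finset.sum_subtype_eq_sum_filter f
  rw [h, ← Finset.sum_filter]
  refine Finset.sum_congr ?_ fun _ _ => rfl
  ext n
  simp only [Finset.mem_filter, Finset.mem_Icc, Finset.mem_range]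
  constructor
  · rintro ⟨⟨-, h1⟩, h2⟩
    exact ⟨by omega, h2⟩
  · rintro ⟨h1, h2⟩
    exact ⟨⟨h2.one_le, by omega⟩, h2⟩

/-- Evaluation of a partial sum over the primes `p ≤ N`. -/
theorem sum_primesUpTo_apply {D : Set ℂ} (G : Nat.Primes → HolFun D) (N : ℕ) (s : D) :
    ((∑ p ∈ primesUpTo N, G p : HolFun D) : C(D, ℂ)) s = ∑ n ∈ Finset.range (N + 1),
      if h : n.Prime then (G ⟨n, h⟩ : C(D, ℂ)) s else 0 := by
  obtain ⟨φ, hφ⟩ : ∃ φ : ℕ → ℂ, ∀ n, φ n =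
      if h : n.Prime then (G ⟨n, h⟩ : C(D, ℂ)) s else 0 := ⟨_, fun _ => rfl⟩
  have h1 : ((∑ p ∈ primesUpTo N, G p : HolFun D) : C(D, ℂ)) s = ∑ p ∈ primesUpTo N, φ p := by
    rw [Submodule.coe_sum, ContinuousMap.sum_apply]
    refine Finset.sum_congr rfl fun p _ => ?_
    rw [hφ, dif_pos p.2]
    rfl
  rw [h1, sum_primesUpTo φ N]
  refine Finset.sum_congr rfl fun n _ => ?_
  rw [hφ]
  split_ifs <;> rfl

/-! ### Approximation by sums of convergent series -/

/-- Approximation on a single compact set by a sum of a convergent series. With `ω(p) = 1` for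
`p ≤ N`, the rest of the function is approximated by a combination of the `a_j(p) p^{-s}` over
finitely many `p > N`, the coefficients of which are then rounded to modulus one. -/
theorem exists_convergentSeries_near {m : ℕ} {L : Fin m → SelbergClass}
    (hA : SelbergStrongA L) (hB : SelbergStrongB L) {σ₁ σ₂ : ℝ} (hσ₁ : 1 / 2 < σ₁) (hσ₂ : σ₂ < 1)
    (f : Fin m → HolFun (verticalStrip σ₁ σ₂)) {K : Set (verticalStrip σ₁ σ₂)} (hK : IsCompact K)
    {ε : ℝ} (hε : 0 < ε) :
    ∃ g ∈ convergentSeries L (verticalStrip σ₁ σ₂), ∀ j, ∀ s ∈ K,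
      ‖(g j : C(verticalStrip σ₁ σ₂, ℂ)) s - (f j : C(verticalStrip σ₁ σ₂, ℂ)) s‖ < ε := by
  have hDo : IsOpen (verticalStrip σ₁ σ₂) := isOpen_verticalStrip σ₁ σ₂
  set a : Fin m → ℕ → ℂ := fun j => (L j).a with ha
  have hram : ∀ ε : ℝ, 0 < ε → ∀ j, ∃ C : ℝ, ∀ n : ℕ, 1 ≤ n → ‖a j n‖ ≤ C * (n : ℝ) ^ ε :=
    fun ε hε j => (L j).exists_norm_a_le hε
  obtain ⟨c, hc, hdiag⟩ := hA.exists_tendsto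
  choose τ v hτ hv0 hv hb using fun j => (L j).exists_higher_bound hσ₁
  choose Gf hGf1 hGf2 using fun (p : Nat.Primes) (j : Fin m) (ω : Circle) =>
    (L j).exists_localLog (σ₂ := σ₂) (hv j) (hb j) p.2 ω
  -- bound for the sum over `k ≥ 2` in the local factors at the prime `n`
  set ρ : ℕ → ℝ := fun n => ∑ j, (∑' k, v j k) * (n : ℝ) ^ (-τ j) with hρ
  have hV0 : ∀ j, 0 ≤ ∑' k, v j k := fun j => tsum_nonneg (hv0 j)
  have hρsum : Summable ρ := summable_sum fun j _ =>
    (Real.summable_nat_rpow.mpr (by linarith [hτ j])).mul_left _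
  have hρ0 : ∀ n, 0 ≤ ρ n := fun n => Finset.sum_nonneg fun j _ =>
    mul_nonneg (hV0 j) (by positivity)
  have hρle : ∀ (j : Fin m) (n : ℕ), (∑' k, v j k) * (n : ℝ) ^ (-τ j) ≤ ρ n := fun j n =>
    Finset.single_le_sum (f := fun j => (∑' k, v j k) * (n : ℝ) ^ (-τ j))
      (fun j _ => mul_nonneg (hV0 j) (by positivity)) (Finset.mem_univ j)
  -- the effect of rounding on the compact set `K`
  obtain ⟨δ, R, hδ, hR, hKb⟩ := exists_bounds_of_isCompact hK
  set Λ : ℝ := R * ∑' n : ℕ, (n : ℝ) ^ (-(1 + δ)) with hΛ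
  have hΛ0 : 0 ≤ Λ := mul_nonneg hR (tsum_nonneg fun n => by positivity)
  set η : ℝ := ε / 3 / (Λ + 1) with hη
  have hη0 : 0 < η := by positivity
  have hηΛ : η * Λ ≤ ε / 3 := by
    rw [hη, div_mul_eq_mul_div, div_le_iff₀ (by positivity)]
    nlinarith
  obtain ⟨N₁, hN₁⟩ := exists_tail_sum_lt hρsum (show 0 < ε / 3 by positivity)
  obtain ⟨N₂, hN₂⟩ := exists_tail_sum_lt (summable_sq_norm_coeffVector hram hσ₁)
    (show 0 < η ^ 2 / 4 by positivity)
  set N := max N₁ N₂ with hN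
  -- approximation by a finite combination with coefficients of modulus at most one
  have hcompact : CompactSpace K := isCompact_iff_compactSpace.mp hK
  obtain ⟨z, hz1, hz2, hz3⟩ : ∃ z : ℕ →₀ ℂ, (∀ n, ‖z n‖ ≤ 1) ∧
      (∀ n, z n ≠ 0 → n.Prime ∧ N < n) ∧ ∀ j, ∀ s ∈ K,
        ‖(f j : C(verticalStrip σ₁ σ₂, ℂ)) s -
            (∑ p ∈ primesUpTo N, (Gf p j 1 : C(verticalStrip σ₁ σ₂, ℂ)) s) -
          ∑ n ∈ z.support, z n * (a j n * expLog s n)‖ < ε / 3 := by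
    set h : Fin m → HolFun (verticalStrip σ₁ σ₂) := fun j => f j - ∑ p ∈ primesUpTo N, Gf p j 1 with hh
    choose e hed he using fun j => (h j).2
    obtain ⟨z, hz1, hz2, hz3⟩ := exists_combination_near (X := K) (a := a) hram hc hdiag
      (fun j k κ => hB.tendsto j k κ) (by linarith) hσ₂
      (s := ⟨fun x => ((x : verticalStrip σ₁ σ₂) : ℂ), by fun_prop⟩)
      (fun x => (x : verticalStrip σ₁ σ₂).2) hed N
      (show 0 < ε / 3 by positivity)
    refine ⟨z, hz1, hz2, fun j s hs => ?_⟩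
    have h1 := hz3 j ⟨s, hs⟩
    have h2 : e j s = (f j : C(verticalStrip σ₁ σ₂, ℂ)) s -
        ∑ p ∈ primesUpTo N, (Gf p j 1 : C(verticalStrip σ₁ σ₂, ℂ)) s := by
      rw [he, hh]
      simp only [Submodule.coe_sub, Submodule.coe_sum, ContinuousMap.sub_apply,
        ContinuousMap.sum_apply]
    have h3 : ∀ n, expLog s n = Complex.exp (-(Real.log n : ℝ) * s) := fun n => by
      rw [expLog]; congr 1; ring
    simp only [ContinuousMap.coe_mk, h2] at h1
    simpa only [h3] using h1
  -- rounding to coefficients of modulus one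
  set w : ℕ → EuclideanSpace ℂ (Fin m) := fun n =>
    if n.Prime ∧ N < n then coeffVector a σ₁ n else 0 with hw
  obtain ⟨ω, hω⟩ := exists_circle_rounding w hz1
  -- the rounding errors, as coefficients of a Dirichlet series in `s - σ₁`
  set cf : Fin m → ℕ → ℂ := fun j n => (z n - (ω n : ℂ)) *
    (if n.Prime ∧ N < n then a j n * expLog σ₁ n else 0) with hcf
  have hcfsum : ∀ j k, ‖∑ n ∈ Finset.range k, cf j n‖ ≤ η := by
    intro j k
    have h1 : ∑ n ∈ Finset.range k, cf j n =
        (∑ n ∈ Finset.range k, (z n - (ω n : ℂ)) • w n) j := by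
      rw [WithLp.ofLp_sum, Finset.sum_apply]
      refine Finset.sum_congr rfl fun n _ => ?_
      rw [PiLp.smul_apply, smul_eq_mul]
      simp only [hcf, hw, coeffVector]
      congr 1
      split_ifs <;> simp
    have h2 : ∑ n ∈ Finset.range k, ‖w n‖ ^ 2 < η ^ 2 / 4 := by
      have h3 := hN₂ ((Finset.range k).filter fun n => n.Prime ∧ N < n) fun n hn =>
        (le_max_right N₁ N₂).trans (Finset.mem_filter.mp hn).2.2.le
      rw [Finset.sum_filter] at h3
      refine lt_of_le_of_lt (Finset.sum_le_sum fun n _ => ?_) h3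
      simp only [hw]
      split_ifs <;> simp
    have h4 := hω k
    rw [h1]
    refine (PiLp.norm_apply_le _ j).trans (le_of_sq_le_sq ?_ hη0.le)
    linarith
  have hcf0 : ∀ j, cf j 0 = 0 := fun j => by simp [hcf, Nat.not_prime_zero]
  choose Fl hFl using fun j => exists_tendstoUniformlyOn_dirichlet (hcf0 j) (hcfsum j)
  -- the point of the torus and the local factors there
  set Ω : InfiniteTorus := fun p => if N < (p : ℕ) then ω p else 1 with hΩ
  set G : Nat.Primes → Fin m → HolFun (verticalStrip σ₁ σ₂) := fun p j => Gf p j (Ω p) with hG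
  set g : Fin m → ℕ → verticalStrip σ₁ σ₂ → ℂ := fun j n s =>
    if h : n.Prime then (G ⟨n, h⟩ j : C(verticalStrip σ₁ σ₂, ℂ)) s else 0 with hg
  -- the part of the local factors at the primes `p > N` which comes from the powers `k ≥ 2`
  set r : Fin m → ℕ → verticalStrip σ₁ σ₂ → ℂ := fun j n s =>
    if n.Prime ∧ N < n then g j n s - ω n * (a j n * expLog s n) else 0 with hr
  have hrbound : ∀ j n (s : verticalStrip σ₁ σ₂), ‖r j n s‖ ≤ if N < n then ρ n else 0 := by
    intro j n s
    simp only [hr]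
    by_cases hn : n.Prime ∧ N < n
    · rw [if_pos hn, if_pos hn.2]
      have h1 := hGf2 ⟨n, hn.1⟩ j (ω n) s
      refine le_trans ?_ (h1.trans (hρle j n))
      simp only [hg, hG, hΩ, dif_pos hn.1, if_pos hn.2]
      exact le_rfl
    · rw [if_neg hn, norm_zero]
      split_ifs
      · exact hρ0 n
      · exact le_rfl
  have hrsum : Summable fun n => if N < n then ρ n else 0 :=
    Summable.of_nonneg_of_le (fun n => by split_ifs; exacts [hρ0 n, le_rfl])
      (fun n => by split_ifs; exacts [le_rfl, hρ0 n]) hρsum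
  -- local factors at `p ≤ N`, the finite combination, the rounding errors, and higher powers
  have hdecomp : ∀ j n (s : verticalStrip σ₁ σ₂), g j n s = (if n ≤ N then g j n s else 0) +
      z n * (a j n * expLog s n) - cf j n * expLog (s - σ₁) n + r j n s := by
    intro j n s
    have hzn : ¬(n.Prime ∧ N < n) → z n = 0 := fun h => by
      by_contra hne
      exact h (hz2 n hne)
    by_cases hn : n.Prime ∧ N < n
    · have h1 : expLog σ₁ n * expLog (s - σ₁) n = expLog s n := by
        rw [expLog_mul_expLog]; congr 1; ring
      simp only [hr, hcf, if_pos hn, if_neg (not_le.mpr hn.2)]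
      rw [← h1]
      ring
    · rw [hzn hn]
      simp only [hr, hcf, if_neg hn]
      by_cases hnN : n ≤ N
      · simp [hnN]
      · have : ¬ n.Prime := fun h => hn ⟨h, not_le.mp hnN⟩
        simp [hg, this]
  set U : Fin m → verticalStrip σ₁ σ₂ → ℂ := fun j s => ∑ n ∈ Finset.range (N + 1), g j n s +
    ∑ n ∈ z.support, z n * (a j n * expLog s n) with hU
  -- the first two parts have only finitely many nonzero terms
  have hUev : ∀ j, ∀ᶠ k : ℕ in atTop, ∀ s : verticalStrip σ₁ σ₂,
      ∑ n ∈ Finset.range k, ((if n ≤ N then g j n s else 0) +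
      z n * (a j n * expLog s n)) = U j s := by
    intro j
    filter_upwards [eventually_ge_atTop (N + 1), eventually_ge_atTop (z.support.sup id + 1)]
      with k hk1 hk2 s
    rw [Finset.sum_add_distrib, hU]
    congr 1
    · rw [← Finset.sum_filter]
      refine Finset.sum_congr ?_ fun _ _ => rfl
      ext n
      simp only [Finset.mem_filter, Finset.mem_range]
      omega
    · symm
      refine Finset.sum_subset (fun n hn => Finset.mem_range.mpr ?_) fun n _ hn => ?_
      · have : n ≤ z.support.sup id := Finset.le_sup (f := id) hn
        omega
      · rw [Finsupp.notMem_support_iff.mp hn, zero_mul]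
  have hrR : ∀ j (s : verticalStrip σ₁ σ₂), ‖∑' n, r j n s‖ ≤ ε / 3 := by
    intro j s
    have hs : Summable fun n => r j n s := Summable.of_norm_bounded hrsum fun n => hrbound j n s
    refine le_of_tendsto hs.hasSum.tendsto_sum_nat.norm (Eventually.of_forall fun k => ?_)
    have h1 := hN₁ ((Finset.range k).filter fun n => N < n) fun n hn =>
      (le_max_left N₁ N₂).trans (Finset.mem_filter.mp hn).2.le
    rw [Finset.sum_filter] at h1
    exact ((norm_sum_le _ _).trans (Finset.sum_le_sum fun n _ => hrbound j n s)).trans h1.le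
  have hlim : ∀ j, ∀ K' : Set (verticalStrip σ₁ σ₂), IsCompact K' →
      TendstoUniformlyOn (fun (k : ℕ) (s : verticalStrip σ₁ σ₂) =>
          ((∑ p ∈ primesUpTo k, G p j : HolFun (verticalStrip σ₁ σ₂)) :
            C(verticalStrip σ₁ σ₂, ℂ)) s)
        (fun s => U j s - Fl j (s - σ₁) + ∑' n, r j n s) atTop K' := by
    intro j K' hK'
    obtain ⟨δ', R', hδ', hR', hKb'⟩ := exists_bounds_of_isCompact hK'
    have h1 : TendstoUniformlyOn (fun (k : ℕ) (s : verticalStrip σ₁ σ₂) =>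
        ∑ n ∈ Finset.range k,
        ((if n ≤ N then g j n s else 0) + z n * (a j n * expLog s n))) (U j) atTop K' :=
      tendstoUniformlyOn_const_of_eventually_eq (hUev j)
    have h2 : TendstoUniformlyOn (fun (k : ℕ) (s : verticalStrip σ₁ σ₂) =>
        ∑ n ∈ Finset.range k,
        cf j n * expLog ((s : ℂ) - σ₁) n) (fun s => Fl j ((s : ℂ) - σ₁)) atTop K' :=
      ((hFl j δ' R' hδ' hR').1.comp fun s : verticalStrip σ₁ σ₂ => (s : ℂ) - σ₁).mono
        fun s hs => hKb' s hs
    have h3 : TendstoUniformlyOn (fun (k : ℕ) (s : verticalStrip σ₁ σ₂) =>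
        ∑ n ∈ Finset.range k, r j n s)
        (fun s => ∑' n, r j n s) atTop K' :=
      tendstoUniformlyOn_tsum_nat hrsum fun n s _ => hrbound j n s
    have h4 := (h1.sub h2).add h3
    intro u hu
    refine ((tendsto_add_atTop_nat 1).eventually (h4 u hu)).mono fun k hk s hs => ?_
    have h5 : ((∑ p ∈ primesUpTo k, G p j : HolFun (verticalStrip σ₁ σ₂)) :
        C(verticalStrip σ₁ σ₂, ℂ)) s =
        ∑ n ∈ Finset.range (k + 1), ((if n ≤ N then g j n s else 0) +
          z n * (a j n * expLog s n)) - ∑ n ∈ Finset.range (k + 1),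
          cf j n * expLog ((s : ℂ) - σ₁) n + ∑ n ∈ Finset.range (k + 1), r j n s := by
      rw [← Finset.sum_sub_distrib, ← Finset.sum_add_distrib, sum_primesUpTo_apply]
      exact Finset.sum_congr rfl fun n _ => hdecomp j n s
    have h6 := hk s hs
    simp only [Pi.add_apply, Pi.sub_apply] at h6
    beta_reduce
    rw [h5]
    exact h6
  choose gl hg1 hg2 using fun j => HolFun.exists_tendsto hDo (hlim j)
  refine ⟨gl, ⟨Ω, G, fun p j s => hGf1 p j (Ω p) s, ?_⟩, fun j s hs => ?_⟩
  · rw [tendsto_pi_nhds]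
    intro j
    simpa only [Finset.sum_apply] using hg2 j
  · have h1 := hz3 j s hs
    have h2 := (hFl j δ R hδ hR).2 (s - σ₁) (hKb s hs).1 (hKb s hs).2
    have h3 := hrR j s
    have h4 : ∑ n ∈ Finset.range (N + 1), g j n s =
        ∑ p ∈ primesUpTo N, (Gf p j 1 : C(verticalStrip σ₁ σ₂, ℂ)) s := by
      refine (sum_primesUpTo_apply (fun p => G p j) N s).symm.trans ?_
      rw [Submodule.coe_sum, ContinuousMap.sum_apply]
      refine Finset.sum_congr rfl fun p hp => ?_
      have hpN : ¬ N < (p : ℕ) := by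
        have := (Finset.mem_Icc.mp (Finset.mem_subtype.mp hp)).2
        omega
      simp only [hG, hΩ, if_neg hpN]
    rw [hg1]
    have h5 : U j s - Fl j (s - σ₁) + ∑' n, r j n s - (f j : C(verticalStrip σ₁ σ₂, ℂ)) s =
        -((f j : C(verticalStrip σ₁ σ₂, ℂ)) s -
            (∑ p ∈ primesUpTo N, (Gf p j 1 : C(verticalStrip σ₁ σ₂, ℂ)) s) -
          ∑ n ∈ z.support, z n * (a j n * expLog s n)) + -Fl j (s - σ₁) + ∑' n, r j n s := by
      simp only [hU, h4]
      ring
    rw [h5]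
    refine (norm_add₃_le).trans_lt ?_
    rw [norm_neg, norm_neg]
    have h6 : ‖Fl j (s - σ₁)‖ ≤ ε / 3 := h2.trans hηΛ
    linarith

theorem mainTheorem2 (m : ℕ) (hm : 1 ≤ m) (L : Fin m → SelbergClass)
    (hA : SelbergStrongA L) (hB : SelbergStrongB L)
    (σ₁ σ₂ : ℝ) (hσ₁ : ∀ j, (L j).meanSquareAbscissa < (σ₁ : EReal))
    (hσ : σ₁ < σ₂) (hσ₂ : σ₂ < 1) :
    Dense (convergentSeries L (verticalStrip σ₁ σ₂)) := by
  obtain ⟨c, hc, hdiag⟩ := hA.exists_tendsto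
  have hhalf : 1 / 2 < σ₁ := by
    have h := hdiag ⟨0, hm⟩ 1 one_pos
    rw [mul_one] at h
    exact half_lt_of_meanSquareAbscissa_lt (hc _) h (hσ₁ _)
  set D := verticalStrip σ₁ σ₂
  have : LocallyCompactSpace D := (isOpen_verticalStrip σ₁ σ₂).locallyCompactSpace
  intro f
  -- a sequence of sums of convergent series approximating `f` along a compact exhaustion
  have E : CompactExhaustion D := default
  choose g hg1 hg2 using fun n : ℕ => exists_convergentSeries_near hA hB hhalf hσ₂ f
    (E.isCompact n) (show (0 : ℝ) < 1 / (n + 1) by positivity)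
  refine mem_closure_of_tendsto (f := g) (b := atTop) ?_ (Eventually.of_forall hg1)
  rw [tendsto_pi_nhds]
  intro j
  rw [HolFun.tendsto_iff]
  intro K hK
  obtain ⟨n₀, hn₀⟩ := E.exists_superset_of_isCompact hK
  rw [Metric.tendstoUniformlyOn_iff]
  intro ε hε
  filter_upwards [eventually_ge_atTop n₀,
    tendsto_one_div_add_atTop_nhds_zero_nat.eventually_lt_const hε] with n hn1 hn2 s hs
  rw [dist_comm, dist_eq_norm]
  exact (hg2 n j s (E.subset hn1 (hn₀ hs))).trans hn2
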